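/- Let $(a;q)_\infty=\prod_{k\ge0}(1-aq^k)$, and let the integers $p_{3,3}(n)$, $n\ge 0$, be defined by $$\sum_{n\ge0}p_{3,3}(n)q^n=\frac{1}{(q;q)_\infty^3\,(q^3;q^3)_\infty^3}.$$ Then for all integers $n\ge0$, \begin{align*} p_{3,3}(12n+6)&\equiv p_{3,3}(12n+9)\equiv 0 \pmod 2,\\ p_{3,3}(6n+4)&\equiv 0\pmod 4,\\ p_{3,3}(3n+1)&\equiv 0\pmod 3,\\ p_{3,3}(3n+2)&\equiv 0\pmod 9,\\ p_{3,3}(9n+5)&\equiv p_{3,3}(9n+8)\equiv 0 \pmod{27},\\ p_{3,3}(5n+3)&\equiv 0\pmod 5. \end{align*} -/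

import Mathlib

open scoped PowerSeries PowerSeries.WithPiTopology

/-- The shifted factorial `(a; q)_∞ = ∏_{k ≥ 0} (1 - a q ^ k)`, as an infinite product in the ring
of formal power series over `ℤ` with the topology of coefficientwise convergence (`ℤ` is discrete). -/
noncomputable def qFactorialInf (a q : ℤ⟦X⟧) : ℤ⟦X⟧ :=
  ∏' k : ℕ, (1 - a * q ^ k)

/-- The product defining `(q^m; q^m)_∞` converges for `m ≥ 1`. -/
theorem multipliable_qFactorialInf {m : ℕ} (hm : m ≠ 0) :
    Multipliable fun k : ℕ => (1 : ℤ⟦X⟧) - PowerSeries.X ^ m * (PowerSeries.X ^ m) ^ k := by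
  simp_rw [sub_eq_add_neg]
  apply PowerSeries.WithPiTopology.multipliable_one_add_of_tendsto_order_atTop_nhds_top
  refine ENat.tendsto_nhds_top_iff_natCast_lt.mpr fun n => Filter.eventually_atTop.mpr ⟨n, ?_⟩
  intro k hk
  rw [PowerSeries.order_neg, ← pow_succ', ← pow_mul, PowerSeries.order_X_pow]
  norm_cast
  calc n < k + 1 := by omega
    _ ≤ m * (k + 1) := Nat.le_mul_of_pos_left _ (Nat.pos_of_ne_zero hm)

theorem constantCoeff_qFactorialInf {m : ℕ} (hm : m ≠ 0) :
    PowerSeries.constantCoeff (qFactorialInf (PowerSeries.X ^ m) (PowerSeries.X ^ m)) = 1 := by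
  have h := (multipliable_qFactorialInf hm).map_tprod (PowerSeries.constantCoeff (R := ℤ))
    (PowerSeries.WithPiTopology.continuous_constantCoeff ℤ)
  rw [qFactorialInf, h]
  simp [hm]

/-- The denominator `(q; q)_∞^3 (q^3; q^3)_∞^3` of the generating function, with `q` the
indeterminate `PowerSeries.X`. -/
noncomputable def p33Denom : ℤ⟦X⟧ :=
  qFactorialInf PowerSeries.X PowerSeries.X ^ 3 *
    qFactorialInf (PowerSeries.X ^ 3) (PowerSeries.X ^ 3) ^ 3

/-- `p33 n` is the coefficient of `q^n` in `1 / ((q; q)_∞^3 (q^3; q^3)_∞^3)`; the denominator has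
constant term `1`, so `PowerSeries.invOfUnit _ 1` is its inverse in `ℤ⟦X⟧` (see `mk_p33_mul`). -/
noncomputable def p33 (n : ℕ) : ℤ :=
  PowerSeries.coeff n (PowerSeries.invOfUnit p33Denom 1)

/-- The defining identity `(∑ p33 n q^n) * ((q; q)_∞^3 (q^3; q^3)_∞^3) = 1`. -/
theorem mk_p33_mul : PowerSeries.mk p33 * p33Denom = 1 := by
  have h : PowerSeries.mk p33 = PowerSeries.invOfUnit p33Denom 1 := by
    ext n
    simp [p33]
  have h1 := constantCoeff_qFactorialInf (m := 1) one_ne_zero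
  have h3 := constantCoeff_qFactorialInf (m := 3) three_ne_zero
  rw [pow_one] at h1
  rw [h, mul_comm]
  apply PowerSeries.mul_invOfUnit
  simp only [p33Denom, map_mul, map_pow, h1, h3]
  simp

/-! Write E_m for (q^m; q^m)_∞, P for the generating function 1/(E_1³ E_3³), and A for `cubicTheta`.
Multiplying by a series in q^m with constant term 1 neither mixes the classes of exponents mod m nor
loses divisibility (`CoeffDvd.of_expand_mul`). So P is multiplied by such a series until it becomes
congruent to one whose bad class visibly vanishes.

Powers of 3. From E_1³ ≡ E_3 mod 3, and its lifts to 9 and 27, suitable multiples of P become 1,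
E_1⁶ and E_1²⁴. The dissection E_1³ = A(q³) − 3q E_9³ (`eulerPhi_pow_three_dissection`) then
isolates the terms with exponent 2 mod 3.

Modulus 5. P becomes F = E_1² E_3². With w = (E_1/E_3)⁴ and z = A/E_3³, the cubic relation gives z³
= w³ + 27q (`cubicTheta_pow_three_mul`), and a logarithmic derivative formula gives F z² = w − 3 q
dw/dq (`cubicTheta_sq_mul`). Hence 4 F z⁵ = (4 − 3 q d/dq) G with G = w⁴ + 108 q w, and 4 − 3n
vanishes mod 5 for n ≡ 3; finally z⁵ ≡ z(q⁵) mod 5.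

Moduli 2 and 4. Mod 4, E_1³ ≡ ψ(q), so the denominator is ψ(q)ψ(q³) = φ(q⁶)ψ(q⁴) + q φ(q²)ψ(q¹²)
(`psiSeries_mul_expand`). Mod 2 this yields a 4-dissection of P; mod 4 the even part of P is found
by multiplying by the denominator at −q.

All theta series come from Jacobi's triple product (`hasSum_thetaTerm`). Derivatives in the variable
u at u = 1 are replaced by coefficients of s after putting u = 1 + s. -/

open PowerSeries Finset Filter Topology

/-! ### Infinite products and their truncations modulo powers of `X` -/

section Congruence

variable {R : Type*} [CommRing R]

theorem PowerSeries.X_pow_dvd_pow_of_constantCoeff_eq_zero {Q : R⟦X⟧} (hQ : constantCoeff Q = 0) (n : ℕ) :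
    (X : R⟦X⟧) ^ n ∣ Q ^ n :=
  pow_dvd_pow_of_dvd (X_dvd_iff.mpr hQ) n

theorem Dvd.dvd.mul_sub_mul {S : Type*} [CommRing S] {d a b a' b' : S} (h : d ∣ a - b) (h' : d ∣ a' - b') :
    d ∣ a * a' - b * b' := by
  have : a * a' - b * b' = (a - b) * a' + b * (a' - b') := by ring
  rw [this]
  exact dvd_add (h.mul_right _) (h'.mul_left _)

end Congruence

/-- The finite product `(a; Q)_n`. -/
def qPochFin {S : Type*} [CommRing S] (a Q : S) (n : ℕ) : S := ∏ k ∈ range n, (1 - a * Q ^ k)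

theorem qPochFin_succ {S : Type*} [CommRing S] (a Q : S) (n : ℕ) :
    qPochFin a Q (n + 1) = qPochFin a Q n * (1 - a * Q ^ n) := prod_range_succ _ _

theorem X_pow_dvd_qPochFin_sub {R : Type*} [CommRing R] (a : R⟦X⟧) {Q : R⟦X⟧} (hQ : constantCoeff Q = 0) {n m : ℕ} (h : n ≤ m) :
    (X : R⟦X⟧) ^ n ∣ qPochFin a Q m - qPochFin a Q n := by
  induction m, h using Nat.le_induction with
  | base => simp
  | succ m hm ih =>
    have : qPochFin a Q (m + 1) - qPochFin a Q n =
        (qPochFin a Q m - qPochFin a Q n) - qPochFin a Q m * a * Q ^ m := by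
      rw [qPochFin_succ]; ring
    rw [this]
    exact dvd_sub ih
      (((pow_dvd_pow _ hm).trans (X_pow_dvd_pow_of_constantCoeff_eq_zero hQ m)).mul_left _)

section Poch

variable {R : Type*} [CommRing R] [TopologicalSpace R]

/-- The infinite product `(a; Q)_∞` over an arbitrary topological coefficient ring. -/
noncomputable def qPoch (a Q : R⟦X⟧) : R⟦X⟧ := ∏' k : ℕ, (1 - a * Q ^ k)

theorem multipliable_qPoch (a : R⟦X⟧) {Q : R⟦X⟧} (hQ : constantCoeff Q = 0) :
    Multipliable fun k : ℕ => 1 - a * Q ^ k := by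
  simp_rw [sub_eq_add_neg]
  apply PowerSeries.WithPiTopology.multipliable_one_add_of_tendsto_order_atTop_nhds_top
  refine ENat.tendsto_nhds_top_iff_natCast_lt.mpr fun n => Filter.eventually_atTop.mpr ⟨n + 1, ?_⟩
  intro k hk
  refine lt_of_lt_of_le (b := ((n + 1 : ℕ) : ℕ∞)) (by norm_cast; omega) ?_
  refine nat_le_order _ _ (X_pow_dvd_iff.mp ?_)
  rw [dvd_neg]
  exact ((pow_dvd_pow _ hk).trans (X_pow_dvd_pow_of_constantCoeff_eq_zero hQ k)).mul_left _

theorem tendsto_qPochFin (a : R⟦X⟧) {Q : R⟦X⟧} (hQ : constantCoeff Q = 0) :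
    Tendsto (qPochFin a Q) atTop (𝓝 (qPoch a Q)) :=
  (multipliable_qPoch a hQ).hasProd.tendsto_prod_nat

theorem map_qPoch [IsTopologicalRing R] {S : Type*} [CommRing S] [TopologicalSpace S] [T2Space S]
    (φ : R⟦X⟧ →+* S⟦X⟧) (hφ : Continuous φ) (a : R⟦X⟧) {Q : R⟦X⟧} (hQ : constantCoeff Q = 0) :
    φ (qPoch a Q) = qPoch (φ a) (φ Q) := by
  rw [qPoch, (multipliable_qPoch a hQ).map_tprod φ hφ, qPoch]
  simp

variable [T2Space R]

/-- Factors with index at least `D` are 1 modulo `X ^ D`; this lets identities of infinite products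
be checked on finite ones. -/
theorem X_pow_dvd_qPoch_sub (a : R⟦X⟧) {Q : R⟦X⟧} (hQ : constantCoeff Q = 0) {D n : ℕ} (h : D ≤ n) :
    (X : R⟦X⟧) ^ D ∣ qPoch a Q - qPochFin a Q n := by
  refine X_pow_dvd_iff.mpr fun m hm => ?_
  rw [map_sub, sub_eq_zero]
  refine tendsto_nhds_unique
    (((PowerSeries.WithPiTopology.continuous_coeff R m).tendsto _).comp (tendsto_qPochFin a hQ)) ?_
  refine tendsto_atTop_of_eventually_const (i₀ := n) fun i hi => ?_
  have := X_pow_dvd_iff.mp (X_pow_dvd_qPochFin_sub a hQ hi) m (by omega)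
  rwa [map_sub, sub_eq_zero] at this

theorem constantCoeff_qPoch [IsTopologicalRing R] (a : R⟦X⟧) {Q : R⟦X⟧} (hQ : constantCoeff Q = 0) :
    constantCoeff (qPoch a Q) = 1 - constantCoeff a := by
  have h := X_pow_dvd_qPoch_sub a hQ (le_refl 1)
  rw [pow_one, X_dvd_iff, map_sub, sub_eq_zero] at h
  simp [h, qPochFin]

theorem qPochFin_mul {S : Type*} [CommRing S] (a Q : S) (m n : ℕ) :
    qPochFin a Q (m * n) = ∏ r ∈ range m, qPochFin (a * Q ^ r) (Q ^ m) n := by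
  induction n with
  | zero => simp [qPochFin]
  | succ n ih =>
    rw [Nat.mul_succ, qPochFin, prod_range_add, ← qPochFin, ih, ← prod_mul_distrib]
    refine prod_congr rfl fun r _ => ?_
    rw [qPochFin_succ]
    congr 2
    ring

theorem qPoch_eq_prod [IsTopologicalRing R] (a : R⟦X⟧) {Q : R⟦X⟧} (hQ : constantCoeff Q = 0) {m : ℕ}
    (hm : m ≠ 0) : qPoch a Q = ∏ r ∈ range m, qPoch (a * Q ^ r) (Q ^ m) := by
  have hQm : constantCoeff (Q ^ m) = 0 := by simp [hQ, hm]
  refine tendsto_nhds_unique ((tendsto_qPochFin a hQ).comp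
    (tendsto_id.const_mul_atTop' (Nat.pos_of_ne_zero hm))) ?_
  have := tendsto_finsetProd (range m) fun r (_ : r ∈ range m) => tendsto_qPochFin (a * Q ^ r) hQm
  refine this.congr fun n => ?_
  simp [qPochFin_mul]

theorem qPoch_mul_qPoch_neg [IsTopologicalRing R] (a : R⟦X⟧) {Q : R⟦X⟧} (hQ : constantCoeff Q = 0) :
    qPoch a Q * qPoch (-a) Q = qPoch (a ^ 2) (Q ^ 2) := by
  rw [qPoch, qPoch, ← (multipliable_qPoch a hQ).tprod_mul (multipliable_qPoch (-a) hQ), qPoch]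
  congr 1
  ext1 k
  ring

theorem qPoch_mul_cube_roots [IsTopologicalRing R] (a : R⟦X⟧) {Q w : R⟦X⟧} (hQ : constantCoeff Q = 0)
    (hw : 1 + w + w ^ 2 = 0) :
    qPoch a Q * qPoch (w * a) Q * qPoch (w ^ 2 * a) Q = qPoch (a ^ 3) (Q ^ 3) := by
  rw [qPoch, qPoch, qPoch, ← (multipliable_qPoch a hQ).tprod_mul (multipliable_qPoch (w * a) hQ),
    ← ((multipliable_qPoch a hQ).mul (multipliable_qPoch (w * a) hQ)).tprod_mul
      (multipliable_qPoch (w ^ 2 * a) hQ), qPoch]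
  congr 1
  ext1 k
  linear_combination (-a * Q ^ k + w * (a * Q ^ k) ^ 2 + (1 - w) * (a * Q ^ k) ^ 3) * hw

end Poch

/-! ### Finite and infinite triple product -/

/-- The `j`-th term `(-1)^j (ab)^{j(j-1)/2} a^j` of Ramanujan's theta series, which for negative `j`
is `(-1)^j (ab)^{|j|(|j|-1)/2} b^{|j|}`. -/
def thetaTerm {S : Type*} [CommRing S] (a b : S) : ℤ → S
  | Int.ofNat n => (a * b) ^ n.choose 2 * (-a) ^ n
  | Int.negSucc n => (a * b) ^ (n + 1).choose 2 * (-b) ^ (n + 1)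

section Theta

variable {S : Type*} [CommRing S] (a b : S)

theorem thetaTerm_natCast (n : ℕ) : thetaTerm a b n = (a * b) ^ n.choose 2 * (-a) ^ n := rfl

theorem thetaTerm_neg_natCast (n : ℕ) : thetaTerm a b (-n) = (a * b) ^ n.choose 2 * (-b) ^ n := by
  cases n with
  | zero => simp [thetaTerm]
  | succ n => rfl

/-- Consecutive terms have ratio −a (ab)^j. Since `j` may be negative, the exponent is written as a
difference `m - k` of naturals and cleared. -/
theorem mul_thetaTerm {j : ℤ} {m k : ℕ} (h : j + k = m) :
    -a * (a * b) ^ m * thetaTerm a b j = (a * b) ^ k * thetaTerm a b (j + 1) := by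
  obtain ⟨n, rfl | rfl⟩ := j.eq_nat_or_neg
  · obtain rfl : m = n + k := by omega
    have : ((n : ℤ) + 1) = ((n + 1 : ℕ) : ℤ) := by push_cast; rfl
    rw [this, thetaTerm_natCast, thetaTerm_natCast, Nat.choose_succ_succ' n 1, Nat.choose_one_right]
    ring
  · cases n with
    | zero =>
      obtain rfl : m = k := by simpa using h.symm
      simp [thetaTerm]
      ring
    | succ n =>
      obtain rfl : k = m + n + 1 := by omega
      have : (-((n + 1 : ℕ) : ℤ) + 1) = -(n : ℤ) := by push_cast; ring
      rw [this, thetaTerm_neg_natCast, thetaTerm_neg_natCast, Nat.choose_succ_succ' n 1,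
        Nat.choose_one_right]
      ring

end Theta

section GaussBinomial

variable {R : Type*} [CommRing R]

theorem constantCoeff_qPochFin_self {Q : R⟦X⟧} (hQ : constantCoeff Q = 0) (n : ℕ) :
    constantCoeff (qPochFin Q Q n) = 1 := by
  simp [qPochFin, hQ]

/-- The inverse of `(Q; Q)_n` for `Q` without constant term. -/
noncomputable def qPochFinInv (Q : R⟦X⟧) (n : ℕ) : R⟦X⟧ := invOfUnit (qPochFin Q Q n) 1

theorem qPochFin_mul_inv {Q : R⟦X⟧} (hQ : constantCoeff Q = 0) (n : ℕ) :
    qPochFin Q Q n * qPochFinInv Q n = 1 :=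
  mul_invOfUnit _ _ (by simp [constantCoeff_qPochFin_self hQ])

theorem qPochFinInv_eq {Q : R⟦X⟧} (hQ : constantCoeff Q = 0) (n : ℕ) :
    qPochFinInv Q n = qPochFinInv Q (n + 1) * (1 - Q ^ (n + 1)) := by
  have h1 := qPochFin_mul_inv hQ n
  have h2 := qPochFin_mul_inv hQ (n + 1)
  rw [qPochFin_succ] at h2
  linear_combination (-qPochFinInv Q n) * h2 + (qPochFinInv Q (n + 1) * (1 - Q * Q ^ n)) * h1

/-- The Gaussian binomial coefficient `(Q; Q)_{i+k} / ((Q; Q)_i (Q; Q)_k)`. -/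
noncomputable def gaussBinom (Q : R⟦X⟧) (i k : ℕ) : R⟦X⟧ :=
  qPochFin Q Q (i + k) * qPochFinInv Q i * qPochFinInv Q k

theorem gaussBinom_comm (Q : R⟦X⟧) (i k : ℕ) : gaussBinom Q i k = gaussBinom Q k i := by
  rw [gaussBinom, gaussBinom, add_comm]; ring

theorem gaussBinom_zero_left {Q : R⟦X⟧} (hQ : constantCoeff Q = 0) (k : ℕ) :
    gaussBinom Q 0 k = 1 := by
  have h := qPochFin_mul_inv hQ 0
  have : qPochFin Q Q 0 = 1 := by simp [qPochFin]
  rw [this, one_mul] at h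
  rw [gaussBinom, h, mul_one, zero_add, qPochFin_mul_inv hQ]

theorem gaussBinom_succ_succ {Q : R⟦X⟧} (hQ : constantCoeff Q = 0) (i k : ℕ) :
    gaussBinom Q (i + 1) (k + 1) =
      gaussBinom Q (i + 1) k + Q ^ (k + 1) * gaussBinom Q i (k + 1) := by
  simp only [gaussBinom, qPochFinInv_eq hQ i, qPochFinInv_eq hQ k]
  rw [show i + 1 + (k + 1) = i + k + 1 + 1 by ring, show i + 1 + k = i + k + 1 by ring,
    show i + (k + 1) = i + k + 1 by ring, qPochFin_succ Q Q (i + k + 1)]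
  ring

/-- The q-Pascal rule in abstract form: a factor `1 + c` raises the row by one as soon as `c` shifts
the weights `t`. It serves both the q-binomial theorem and the finite triple product. -/
theorem sum_gaussBinom_mul_one_add {Q : R⟦X⟧} (hQ : constantCoeff Q = 0) (N : ℕ) (t : ℕ → R⟦X⟧)
    (c : R⟦X⟧) (h : ∀ i k, i + k = N → c * t i = Q ^ k * t (i + 1)) :
    (∑ p ∈ antidiagonal N, gaussBinom Q p.1 p.2 * t p.1) * (1 + c) =
      ∑ p ∈ antidiagonal (N + 1), gaussBinom Q p.1 p.2 * t p.1 := by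
  let u : ℕ × ℕ → R⟦X⟧ := fun p => if p.2 = 0 then 0 else gaussBinom Q p.1 (p.2 - 1) * t p.1
  let v : ℕ × ℕ → R⟦X⟧ := fun p => if p.1 = 0 then 0 else Q ^ p.2 * gaussBinom Q (p.1 - 1) p.2 * t p.1
  have huv : ∀ p ∈ antidiagonal (N + 1), gaussBinom Q p.1 p.2 * t p.1 = u p + v p := by
    rintro ⟨i, k⟩ hp
    rw [HasAntidiagonal.mem_antidiagonal] at hp
    dsimp only at hp
    rcases i with _ | i <;> rcases k with _ | k
    · omega
    · simp [u, v, gaussBinom_zero_left hQ]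
    · simp [u, v, gaussBinom_comm _ _ 0, gaussBinom_zero_left hQ]
    · simp only [u, v, gaussBinom_succ_succ hQ]
      simp
      ring
  rw [sum_congr rfl huv, sum_add_distrib, Nat.sum_antidiagonal_succ', Nat.sum_antidiagonal_succ]
  simp only [u, v, if_true, zero_add, Nat.add_sub_cancel, Nat.succ_ne_zero, if_false]
  rw [mul_add, mul_one, sum_mul]
  congr 1
  refine sum_congr rfl fun p hp => ?_
  have := h p.1 p.2 (HasAntidiagonal.mem_antidiagonal.mp hp)
  linear_combination gaussBinom Q p.1 p.2 * this

theorem qPochFin_eq_sum {Q : R⟦X⟧} (hQ : constantCoeff Q = 0) (b : R⟦X⟧) (n : ℕ) :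
    qPochFin b Q n = ∑ p ∈ antidiagonal n, gaussBinom Q p.1 p.2 * (Q ^ p.1.choose 2 * (-b) ^ p.1) := by
  induction n with
  | zero => simp [qPochFin, gaussBinom_zero_left hQ]
  | succ n ih =>
    rw [qPochFin_succ, ih, sub_eq_add_neg]
    refine sum_gaussBinom_mul_one_add hQ n (fun i => Q ^ i.choose 2 * (-b) ^ i) _ ?_
    rintro i k rfl
    rw [Nat.choose_succ_succ' i 1, Nat.choose_one_right]
    ring

/-- Finite triple product, by induction on `m`. The base case is the q-binomial theorem with the
antidiagonal reversed. -/
theorem qPochFin_mul_qPochFin_eq_sum {a b : R⟦X⟧} (hQ : constantCoeff (a * b) = 0) (n m : ℕ) :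
    qPochFin b (a * b) n * qPochFin a (a * b) m =
      ∑ p ∈ antidiagonal (n + m), gaussBinom (a * b) p.1 p.2 * thetaTerm a b (p.1 - n) := by
  induction m with
  | zero =>
    rw [qPochFin_eq_sum hQ, ← Nat.sum_antidiagonal_swap]
    simp only [qPochFin, range_zero, prod_empty, mul_one, add_zero]
    refine sum_congr rfl fun p hp => ?_
    rw [HasAntidiagonal.mem_antidiagonal] at hp
    have : (p.1 : ℤ) - n = -(p.2 : ℤ) := by omega
    rw [this, thetaTerm_neg_natCast, Prod.fst_swap, Prod.snd_swap, gaussBinom_comm]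
  | succ m ih =>
    rw [qPochFin_succ, ← mul_assoc, ih, sub_eq_add_neg]
    refine sum_gaussBinom_mul_one_add hQ (n + m) (fun i => thetaTerm a b (i - n)) _ ?_
    intro i k hik
    have := mul_thetaTerm a b (j := (i : ℤ) - n) (m := m) (k := k) (by omega)
    rw [show ((i + 1 : ℕ) : ℤ) - n = (i : ℤ) - n + 1 by push_cast; ring, ← this]
    ring

theorem X_pow_dvd_thetaTerm {a b : R⟦X⟧} (hQ : constantCoeff (a * b) = 0) {j : ℤ} {D : ℕ}
    (h : D < j.natAbs) : (X : R⟦X⟧) ^ D ∣ thetaTerm a b j := by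
  have key : ∀ n : ℕ, D < n → D ≤ n.choose 2 := by
    intro n hn
    obtain ⟨n, rfl⟩ : ∃ l, n = l + 1 := ⟨n - 1, by omega⟩
    rw [Nat.choose_succ_succ' n 1, Nat.choose_one_right]
    omega
  obtain ⟨n, rfl | rfl⟩ := j.eq_nat_or_neg
  · rw [thetaTerm_natCast]
    exact ((pow_dvd_pow _ (key n (by simpa using h))).trans
      (X_pow_dvd_pow_of_constantCoeff_eq_zero hQ _)).mul_right _
  · rw [thetaTerm_neg_natCast]
    exact ((pow_dvd_pow _ (key n (by simpa using h))).trans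
      (X_pow_dvd_pow_of_constantCoeff_eq_zero hQ _)).mul_right _

end GaussBinomial

section TripleProduct

variable {R : Type*} [CommRing R] [TopologicalSpace R] [T2Space R]

/-- Gaussian binomials tend to 1/(Q; Q)_∞ when both indices grow. -/
theorem X_pow_dvd_qPoch_mul_gaussBinom_sub_one {Q : R⟦X⟧} (hQ : constantCoeff Q = 0) {D i k : ℕ}
    (hi : D ≤ i) (hk : D ≤ k) : (X : R⟦X⟧) ^ D ∣ qPoch Q Q * gaussBinom Q i k - 1 := by
  have h1 := (X_pow_dvd_qPoch_sub Q hQ hi).mul_right (qPochFinInv Q i)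
  rw [sub_mul, qPochFin_mul_inv hQ] at h1
  have h2 := (pow_dvd_pow _ hk).trans (X_pow_dvd_qPochFin_sub Q hQ (Nat.le_add_left k i))
  have h2 := h2.mul_right (qPochFinInv Q k)
  rw [sub_mul, qPochFin_mul_inv hQ] at h2
  have := h1.mul_sub_mul h2
  convert this using 1
  rw [gaussBinom]; ring

theorem X_pow_dvd_sum_thetaTerm_sub {a b : R⟦X⟧} (hQ : constantCoeff (a * b) = 0) {D n : ℕ}
    (h : 2 * D < n) : (X : R⟦X⟧) ^ D ∣ (∑ p ∈ antidiagonal (n + n), thetaTerm a b (p.1 - n)) -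
      qPoch a (a * b) * qPoch b (a * b) * qPoch (a * b) (a * b) := by
  have h1 : (X : R⟦X⟧) ^ D ∣ (∑ p ∈ antidiagonal (n + n), thetaTerm a b (p.1 - n)) -
      qPoch (a * b) (a * b) * (qPochFin b (a * b) n * qPochFin a (a * b) n) := by
    rw [qPochFin_mul_qPochFin_eq_sum hQ, mul_sum, ← sum_sub_distrib]
    refine dvd_sum fun p hp => ?_
    rw [HasAntidiagonal.mem_antidiagonal] at hp
    by_cases hD : D ≤ p.1 ∧ D ≤ p.2
    · have := (X_pow_dvd_qPoch_mul_gaussBinom_sub_one hQ hD.1 hD.2).mul_right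
        (thetaTerm a b (p.1 - n))
      rw [← dvd_neg]
      convert this using 1
      ring
    -- Near an end of the antidiagonal the Gaussian binomial is not close to its limit, but there
    -- the index is farther than `D` from 0 because `2 * D < n`, so the theta term itself is
    -- negligible.
    · have ht : (X : R⟦X⟧) ^ D ∣ thetaTerm a b (p.1 - n) := X_pow_dvd_thetaTerm hQ (by omega)
      exact dvd_sub ht ((ht.mul_left _).mul_left _)
  have h2 := (X_pow_dvd_qPoch_sub b hQ (show D ≤ n by omega)).mul_sub_mul
    (X_pow_dvd_qPoch_sub a hQ (show D ≤ n by omega))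
  have := dvd_sub h1 (h2.mul_left (qPoch (a * b) (a * b)))
  convert this using 1
  ring

/-- **Jacobi's triple product identity** for formal power series. -/
theorem hasSum_thetaTerm {a b : R⟦X⟧} (hQ : constantCoeff (a * b) = 0) :
    HasSum (thetaTerm a b) (qPoch a (a * b) * qPoch b (a * b) * qPoch (a * b) (a * b)) := by
  refine (PowerSeries.WithPiTopology.hasSum_iff_hasSum_coeff R).mpr fun d => ?_
  set n := 2 * (d + 1) + 1
  have key : coeff d (qPoch a (a * b) * qPoch b (a * b) * qPoch (a * b) (a * b)) =
      ∑ j ∈ Icc (-n : ℤ) n, coeff d (thetaTerm a b j) := by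
    have := X_pow_dvd_iff.mp (X_pow_dvd_sum_thetaTerm_sub (D := d + 1) (n := n) hQ (by omega)) d
      (Nat.lt_succ_self d)
    rw [map_sub, sub_eq_zero, map_sum] at this
    rw [← this]
    refine sum_bij (fun p _ => (p.1 : ℤ) - n) ?_ ?_ ?_ ?_
    · intro p hp
      rw [HasAntidiagonal.mem_antidiagonal] at hp
      rw [mem_Icc]
      omega
    · rintro ⟨i, k⟩ hp ⟨i', k'⟩ hp' h
      rw [HasAntidiagonal.mem_antidiagonal] at hp hp'
      simp only [Prod.mk.injEq] at *
      omega
    · intro j hj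
      rw [mem_Icc] at hj
      refine ⟨((j + n).toNat, (n - j).toNat), ?_, ?_⟩
      · rw [HasAntidiagonal.mem_antidiagonal]
        dsimp only
        omega
      · dsimp only
        omega
    · intros; rfl
  rw [key]
  refine hasSum_sum_of_ne_finset_zero fun j hj => ?_
  refine X_pow_dvd_iff.mp (X_pow_dvd_thetaTerm hQ (D := d + 1) ?_) d (Nat.lt_succ_self d)
  rw [mem_Icc] at hj
  omega

end TripleProduct

/-! ### Triangular and pentagonal exponents, monomial theta series -/

/-- The triangular number `j (j + 1) / 2`. -/
def triangular (j : ℤ) : ℕ := (j * (j + 1) / 2).toNat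

theorem two_mul_triangular (j : ℤ) : 2 * (triangular j : ℤ) = j * (j + 1) := by
  have h : (2 : ℤ) ∣ j * (j + 1) := (Int.even_mul_succ_self j).two_dvd
  have h0 : 0 ≤ j * (j + 1) := by
    rcases le_or_gt 0 j with hj | hj
    · positivity
    · exact mul_nonneg_of_nonpos_of_nonpos hj.le (by omega)
  rw [triangular, Int.toNat_of_nonneg (by positivity), Int.mul_ediv_cancel' h]

/-- The pentagonal number `j (3 j + 1) / 2`. -/
def pentagonalNum (j : ℤ) : ℕ := (j * (3 * j + 1) / 2).toNat

theorem two_mul_pentagonalNum (j : ℤ) : 2 * (pentagonalNum j : ℤ) = j * (3 * j + 1) := by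
  have h : (2 : ℤ) ∣ j * (3 * j + 1) := by
    have := (Int.even_mul_succ_self j).two_dvd
    have h2 : j * (3 * j + 1) = j * (j + 1) + 2 * (j * j) := by ring
    rw [h2]
    exact dvd_add this (dvd_mul_right _ _)
  have h0 : 0 ≤ j * (3 * j + 1) := by
    rcases le_or_gt 0 j with hj | hj
    · positivity
    · exact mul_nonneg_of_nonpos_of_nonpos hj.le (by omega)
  rw [pentagonalNum, Int.toNat_of_nonneg (by positivity), Int.mul_ediv_cancel' h]

section Monomial

variable {R : Type*} [CommRing R]

theorem two_mul_choose_two (n : ℕ) : 2 * (n.choose 2 : ℤ) = n * (n - 1) := by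
  induction n with
  | zero => simp
  | succ n ih =>
    rw [Nat.choose_succ_succ' n 1, Nat.choose_one_right]
    push_cast
    linarith

theorem thetaTerm_monomial (u : Rˣ) (α β e : ℕ) (j : ℤ)
    (he : 2 * (e : ℤ) = (α + β) * j ^ 2 + (α - β) * j) :
    thetaTerm (C (u : R) * X ^ α) (C ((u⁻¹ : Rˣ) : R) * X ^ β) j =
      C (((j.negOnePow : ℤ) : R) * ((u ^ j : Rˣ) : R)) * X ^ e := by
  have hu : C (u : R) * X ^ α * (C ((u⁻¹ : Rˣ) : R) * X ^ β) = X ^ (α + β) := by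
    have : C (u : R) * C ((u⁻¹ : Rˣ) : R) = 1 := by rw [← map_mul, Units.mul_inv, map_one]
    linear_combination (X ^ (α + β)) * this
  obtain ⟨n, rfl | rfl⟩ := j.eq_nat_or_neg
  · rw [thetaTerm_natCast, hu]
    have hen : e = (α + β) * n.choose 2 + α * n := by
      zify
      have := two_mul_choose_two n
      refine mul_left_cancel₀ (two_ne_zero (α := ℤ)) ?_
      linear_combination he - (α + β) * this
    rw [Int.coe_negOnePow_natCast, hen, zpow_natCast, neg_pow]
    simp only [Int.cast_pow, Int.cast_neg, Int.cast_one, Units.val_pow_eq_pow_val, map_mul, map_pow,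
      map_neg, map_one]
    ring
  · rw [thetaTerm_neg_natCast, hu]
    have hen : e = (α + β) * n.choose 2 + β * n := by
      zify
      have := two_mul_choose_two n
      refine mul_left_cancel₀ (two_ne_zero (α := ℤ)) ?_
      linear_combination he - (α + β) * this
    rw [Int.negOnePow_neg, Int.coe_negOnePow_natCast, hen, zpow_neg, ← inv_zpow, zpow_natCast, neg_pow]
    simp only [Int.cast_pow, Int.cast_neg, Int.cast_one, Units.val_pow_eq_pow_val, map_mul, map_pow,
      map_neg, map_one]
    ring

theorem hasSum_thetaTerm_monomial [TopologicalSpace R] [T2Space R] (u : Rˣ) {α β : ℕ}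
    (hαβ : α + β ≠ 0) (e : ℤ → ℕ)
    (he : ∀ j, 2 * (e j : ℤ) = (α + β) * j ^ 2 + (α - β) * j) :
    HasSum (fun j : ℤ => C (((j.negOnePow : ℤ) : R) * ((u ^ j : Rˣ) : R)) * X ^ e j)
      (qPoch (C (u : R) * X ^ α) (X ^ (α + β)) * qPoch (C ((u⁻¹ : Rˣ) : R) * X ^ β) (X ^ (α + β)) *
        qPoch (X ^ (α + β)) (X ^ (α + β))) := by
  have hu : C (u : R) * X ^ α * (C ((u⁻¹ : Rˣ) : R) * X ^ β) = X ^ (α + β) := by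
    have : C (u : R) * C ((u⁻¹ : Rˣ) : R) = 1 := by rw [← map_mul, Units.mul_inv, map_one]
    linear_combination (X ^ (α + β)) * this
  have h := hasSum_thetaTerm (a := C (u : R) * X ^ α) (b := C ((u⁻¹ : Rˣ) : R) * X ^ β)
    (by rw [hu, map_pow, constantCoeff_X, zero_pow hαβ])
  rw [hu] at h
  rwa [funext fun j => thetaTerm_monomial u α β (e j) j (he j)] at h

end Monomial

/-! ### Coefficients in the auxiliary variable s, and continuity -/

section InnerCoeff

variable {R : Type*} [CommRing R]

/-- The coefficient of `s ^ i` of a power series in `X` over `R⟦s⟧`, a power series in `X`. -/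
noncomputable def innerCoeff (i : ℕ) : R⟦X⟧⟦X⟧ →+ R⟦X⟧ where
  toFun f := mk fun n => coeff i (coeff n f)
  map_zero' := by ext; simp
  map_add' _ _ := by ext; simp

theorem coeff_innerCoeff (i n : ℕ) (f : R⟦X⟧⟦X⟧) :
    coeff n (innerCoeff i f) = coeff i (coeff n f) := by
  simp [innerCoeff]

theorem innerCoeff_mul (i : ℕ) (f g : R⟦X⟧⟦X⟧) :
    innerCoeff i (f * g) = ∑ p ∈ antidiagonal i, innerCoeff p.1 f * innerCoeff p.2 g := by
  ext n
  simp only [coeff_innerCoeff, coeff_mul, map_sum]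
  exact sum_comm

theorem innerCoeff_C_mul_X_pow (i n : ℕ) (c : R⟦X⟧) :
    innerCoeff i (C c * X ^ n) = C (coeff i c) * X ^ n := by
  ext m
  simp only [coeff_innerCoeff, coeff_C_mul, coeff_X_pow]
  split_ifs <;> simp

theorem innerCoeff_C (i : ℕ) (c : R⟦X⟧) : innerCoeff i (C c) = C (coeff i c) := by
  simpa using innerCoeff_C_mul_X_pow i 0 c

theorem innerCoeff_map_C (i : ℕ) (f : R⟦X⟧) :
    innerCoeff i (map (C (R := R)) f) = if i = 0 then f else 0 := by
  ext m
  simp only [coeff_innerCoeff, coeff_map, coeff_C]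
  split_ifs <;> simp

theorem innerCoeff_zero (f : R⟦X⟧⟦X⟧) : innerCoeff 0 f = map (constantCoeff (R := R)) f := by
  ext m
  simp [coeff_innerCoeff]

variable [TopologicalSpace R]

theorem PowerSeries.continuous_of_continuous_coeff {Y : Type*} [TopologicalSpace Y] {f : Y → R⟦X⟧}
    (h : ∀ n, Continuous fun y => coeff n (f y)) : Continuous f := by
  refine continuous_iff_continuousAt.mpr fun y => ?_
  rw [ContinuousAt, PowerSeries.WithPiTopology.tendsto_iff_coeff_tendsto]
  exact fun d => (h d).continuousAt

theorem continuous_innerCoeff (i : ℕ) : Continuous (innerCoeff (R := R) i) :=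
  PowerSeries.continuous_of_continuous_coeff fun n => by
    simp only [coeff_innerCoeff]
    exact (PowerSeries.WithPiTopology.continuous_coeff R i).comp
      (PowerSeries.WithPiTopology.continuous_coeff _ n)

theorem PowerSeries.continuous_map {S : Type*} [CommRing S] [TopologicalSpace S] (φ : R →+* S)
    (hφ : Continuous φ) : Continuous (PowerSeries.map φ) :=
  PowerSeries.continuous_of_continuous_coeff fun n => by
    simp only [coeff_map]
    exact hφ.comp (PowerSeries.WithPiTopology.continuous_coeff _ n)

theorem PowerSeries.continuous_expand (p : ℕ) (hp : p ≠ 0) :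
    Continuous (PowerSeries.expand (R := R) p hp) :=
  PowerSeries.continuous_of_continuous_coeff fun n => by
    simp only [coeff_expand]
    split_ifs
    · exact PowerSeries.WithPiTopology.continuous_coeff _ _
    · exact continuous_const

theorem PowerSeries.continuous_rescale [IsTopologicalRing R] (a : R) :
    Continuous (PowerSeries.rescale a) :=
  PowerSeries.continuous_of_continuous_coeff fun n => by
    simp only [coeff_rescale]
    exact (PowerSeries.WithPiTopology.continuous_coeff _ _).const_mul _

end InnerCoeff

/-! ### The operator q d/dq -/

/-- The operator `q d/dq` on formal power series. -/
noncomputable def qDeriv : ℤ⟦X⟧ →+ ℤ⟦X⟧ where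
  toFun f := mk fun n => n * coeff n f
  map_zero' := by ext; simp
  map_add' _ _ := by ext; simp [mul_add]

theorem coeff_qDeriv (n : ℕ) (f : ℤ⟦X⟧) : coeff n (qDeriv f) = n * coeff n f := by
  simp [qDeriv]

theorem qDeriv_eq_X_mul_derivative (f : ℤ⟦X⟧) : qDeriv f = X * PowerSeries.derivative ℤ f := by
  ext n
  rw [coeff_qDeriv]
  cases n with
  | zero => simp
  | succ n =>
    rw [coeff_succ_X_mul, coeff_derivative]
    push_cast
    ring

theorem qDeriv_mul (f g : ℤ⟦X⟧) : qDeriv (f * g) = f * qDeriv g + g * qDeriv f := by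
  simp only [qDeriv_eq_X_mul_derivative, Derivation.leibniz, smul_eq_mul]
  ring

theorem qDeriv_pow_succ (f : ℤ⟦X⟧) (n : ℕ) :
    qDeriv (f ^ (n + 1)) = (n + 1) * f ^ n * qDeriv f := by
  induction n with
  | zero => simp
  | succ n ih =>
    rw [pow_succ, qDeriv_mul, ih]
    push_cast
    ring

theorem qDeriv_X : qDeriv X = X := by
  ext n
  rw [coeff_qDeriv, coeff_X]
  split_ifs with h <;> simp [h]

theorem continuous_qDeriv : Continuous qDeriv :=
  PowerSeries.continuous_of_continuous_coeff fun n => by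
    simp only [coeff_qDeriv]
    exact (PowerSeries.WithPiTopology.continuous_coeff _ _).const_mul _

theorem PowerSeries.coeff_intCast_mul (n : ℕ) (c : ℤ) (f : ℤ⟦X⟧) :
    coeff n ((c : ℤ⟦X⟧) * f) = c * coeff n f := by
  have : (c : ℤ⟦X⟧) = C c := by simp
  rw [this, coeff_C_mul]

theorem qDeriv_intCast_mul_X_pow (c : ℤ) (n : ℕ) :
    qDeriv ((c : ℤ⟦X⟧) * X ^ n) = (((n : ℤ) * c : ℤ) : ℤ⟦X⟧) * X ^ n := by
  ext m
  rw [coeff_qDeriv, coeff_intCast_mul, coeff_intCast_mul, coeff_X_pow]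
  split_ifs with h
  · subst h; simp
  · simp

theorem qDeriv_expand (p : ℕ) (hp : p ≠ 0) (f : ℤ⟦X⟧) :
    qDeriv (f.expand p hp) = ((p : ℤ) : ℤ⟦X⟧) * (qDeriv f).expand p hp := by
  ext n
  rw [coeff_qDeriv, coeff_intCast_mul, coeff_expand, coeff_expand]
  split_ifs with h
  · obtain ⟨m, rfl⟩ := h
    rw [Nat.mul_div_cancel_left _ (Nat.pos_of_ne_zero hp), coeff_qDeriv]
    push_cast
    ring
  · simp

theorem HasSum.of_eq {ι M : Type*} [AddCommMonoid M] [TopologicalSpace M] {f g : ι → M} {a b : M}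
    (h : HasSum f a) (hf : ∀ i, g i = f i) (ha : b = a) : HasSum g b := by
  rwa [funext hf, ha]

instance PowerSeries.charZero_int : CharZero ℤ⟦X⟧ :=
  ⟨fun m n h => by simpa using congrArg (constantCoeff (R := ℤ)) h⟩

/-! ### Euler's function and powers of 1 + s -/

/-- Euler's function `(q; q)_∞`. -/
noncomputable def eulerPhi : ℤ⟦X⟧ := qPoch X X

theorem constantCoeff_eulerPhi : constantCoeff eulerPhi = 1 := by
  rw [eulerPhi, constantCoeff_qPoch _ constantCoeff_X]; simp

theorem eulerPhi_ne_zero : eulerPhi ≠ 0 := fun h => by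
  simpa [h] using constantCoeff_eulerPhi

/-- `1 + s` as a unit of `ℤ⟦s⟧`. -/
noncomputable def onePlus : ℤ⟦X⟧ˣ where
  val := 1 + X
  inv := invOfUnit (1 + X) 1
  val_inv := mul_invOfUnit _ _ (by simp)
  inv_val := by rw [mul_comm]; exact mul_invOfUnit _ _ (by simp)

theorem coeff_zero_onePlus_zpow (j : ℤ) : constantCoeff ((onePlus ^ j : ℤ⟦X⟧ˣ) : ℤ⟦X⟧) = 1 := by
  have h : Units.map (constantCoeff (R := ℤ) : ℤ⟦X⟧ →* ℤ) onePlus = 1 := by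
    ext; simp [onePlus]
  have := map_zpow (Units.map (constantCoeff (R := ℤ) : ℤ⟦X⟧ →* ℤ)) onePlus j
  rw [h, one_zpow] at this
  exact congrArg Units.val this

/-- Pascal's rule for binomial coefficients with integer upper index; two-sided induction on `j`
then gives the coefficients of s, s² and s³. -/
theorem coeff_succ_onePlus_zpow (j : ℤ) (i : ℕ) :
    coeff (i + 1) ((onePlus ^ (j + 1) : ℤ⟦X⟧ˣ) : ℤ⟦X⟧) =
      coeff (i + 1) ((onePlus ^ j : ℤ⟦X⟧ˣ) : ℤ⟦X⟧) + coeff i ((onePlus ^ j : ℤ⟦X⟧ˣ) : ℤ⟦X⟧) := by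
  rw [zpow_add_one, Units.val_mul, show (onePlus : ℤ⟦X⟧) = 1 + X from rfl, mul_add, mul_one, map_add,
    coeff_succ_mul_X]

theorem Int.eq_of_succ_sub_eq {f g : ℤ → ℤ} (h0 : f 0 = g 0)
    (h : ∀ j, f (j + 1) - f j = g (j + 1) - g j) (j : ℤ) : f j = g j := by
  induction j using Int.induction_on with
  | zero => exact h0
  | succ n ih => linarith [h n]
  | pred n ih =>
    have := h (-n - 1)
    rw [sub_add_cancel] at this
    linarith

theorem coeff_one_onePlus_zpow (j : ℤ) : coeff 1 ((onePlus ^ j : ℤ⟦X⟧ˣ) : ℤ⟦X⟧) = j := by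
  refine Int.eq_of_succ_sub_eq (f := fun j => coeff 1 ((onePlus ^ j : ℤ⟦X⟧ˣ) : ℤ⟦X⟧)) (g := id)
    (by simp [coeff_one]) (fun j => ?_) j
  have := coeff_succ_onePlus_zpow j 0
  rw [coeff_zero_eq_constantCoeff_apply, coeff_zero_onePlus_zpow] at this
  simp only [zero_add] at this
  simp [this]

theorem coeff_two_onePlus_zpow (j : ℤ) :
    2 * coeff 2 ((onePlus ^ j : ℤ⟦X⟧ˣ) : ℤ⟦X⟧) = j * (j - 1) := by
  refine Int.eq_of_succ_sub_eq (f := fun j => 2 * coeff 2 ((onePlus ^ j : ℤ⟦X⟧ˣ) : ℤ⟦X⟧))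
    (g := fun j => j * (j - 1)) (by simp [coeff_one]) (fun j => ?_) j
  have := coeff_succ_onePlus_zpow j 1
  rw [coeff_one_onePlus_zpow] at this
  norm_num at this
  rw [this]
  ring

theorem coeff_three_onePlus_zpow (j : ℤ) :
    6 * coeff 3 ((onePlus ^ j : ℤ⟦X⟧ˣ) : ℤ⟦X⟧) = j * (j - 1) * (j - 2) := by
  refine Int.eq_of_succ_sub_eq (f := fun j => 6 * coeff 3 ((onePlus ^ j : ℤ⟦X⟧ˣ) : ℤ⟦X⟧))
    (g := fun j => j * (j - 1) * (j - 2)) (by simp [coeff_one]) (fun j => ?_) j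
  have := coeff_succ_onePlus_zpow j 2
  norm_num at this
  rw [this]
  linear_combination 3 * coeff_two_onePlus_zpow j

theorem coeff_onePlus_inv : coeff 0 ((onePlus⁻¹ : ℤ⟦X⟧ˣ) : ℤ⟦X⟧) = 1 ∧
    coeff 1 ((onePlus⁻¹ : ℤ⟦X⟧ˣ) : ℤ⟦X⟧) = -1 ∧ coeff 2 ((onePlus⁻¹ : ℤ⟦X⟧ˣ) : ℤ⟦X⟧) = 1 ∧
    coeff 3 ((onePlus⁻¹ : ℤ⟦X⟧ˣ) : ℤ⟦X⟧) = -1 := by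
  rw [← zpow_neg_one]
  have h0 := coeff_zero_onePlus_zpow (-1)
  have h1 := coeff_one_onePlus_zpow (-1)
  have h2 := coeff_two_onePlus_zpow (-1)
  have h3 := coeff_three_onePlus_zpow (-1)
  refine ⟨by simpa using h0, h1, by linarith, by linarith⟩

/-- Applying `innerCoeff` to a theta series twisted by powers of `1 + s`. -/
theorem HasSum.innerCoeff_onePlus {σ : ℤ → ℤ} {e : ℤ → ℕ} {f : ℤ⟦X⟧⟦X⟧}
    (h : HasSum (fun j : ℤ => C (((j.negOnePow : ℤ) : ℤ⟦X⟧) * ((onePlus ^ σ j : ℤ⟦X⟧ˣ) : ℤ⟦X⟧)) * X ^ e j) f)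
    (i : ℕ) :
    HasSum (fun j : ℤ => (((j.negOnePow : ℤ) * coeff i ((onePlus ^ σ j : ℤ⟦X⟧ˣ) : ℤ⟦X⟧) : ℤ) : ℤ⟦X⟧) * X ^ e j)
      (innerCoeff i f) := by
  have := h.map (innerCoeff i) (continuous_innerCoeff i)
  refine this.of_eq (fun j => ?_) rfl
  rw [Function.comp, innerCoeff_C_mul_X_pow, coeff_intCast_mul]
  simp

theorem innerCoeff_zero_qPoch {a Q : ℤ⟦X⟧⟦X⟧} (hQ : constantCoeff Q = 0) :
    innerCoeff 0 (qPoch a Q) = qPoch (innerCoeff 0 a) (innerCoeff 0 Q) := by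
  simp only [innerCoeff_zero]
  exact map_qPoch _ (PowerSeries.continuous_map _
    (PowerSeries.WithPiTopology.continuous_constantCoeff _)) _ hQ

theorem map_C_qPoch (a : ℤ⟦X⟧) {Q : ℤ⟦X⟧} (hQ : constantCoeff Q = 0) :
    map (C (R := ℤ)) (qPoch a Q) = qPoch (map C a) (map C Q) :=
  map_qPoch _ (PowerSeries.continuous_map _ PowerSeries.WithPiTopology.continuous_C) _ hQ

theorem expand_qPoch {R : Type*} [CommRing R] [TopologicalSpace R] [IsTopologicalRing R] [T2Space R]
    (p : ℕ) (hp : p ≠ 0) (a : R⟦X⟧) {Q : R⟦X⟧} (hQ : constantCoeff Q = 0) :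
    (qPoch a Q).expand p hp = qPoch (a.expand p hp) (Q.expand p hp) :=
  map_qPoch (PowerSeries.expand p hp : R⟦X⟧ →ₐ[R] R⟦X⟧).toRingHom
    (PowerSeries.continuous_expand p hp) a hQ

theorem qPoch_eq_one_sub_mul {R : Type*} [CommRing R] [TopologicalSpace R] [IsTopologicalRing R] [T2Space R]
    (a : R⟦X⟧) {Q : R⟦X⟧} (hQ : constantCoeff Q = 0) :
    qPoch a Q = (1 - a) * qPoch (a * Q) Q := by
  refine tendsto_nhds_unique ((tendsto_qPochFin a hQ).comp (tendsto_add_atTop_nat 1)) ?_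
  refine ((tendsto_qPochFin (a * Q) hQ).const_mul (1 - a)).congr fun n => ?_
  simp only [Function.comp, qPochFin, prod_range_succ']
  simp [mul_comm, pow_succ, mul_assoc]

/-! ### Jacobi's identity and the first coefficients of `thetaProd` -/

/-- `∏_{n ≥ 1} (1 - u q^n) (1 - u⁻¹ q^n)` with `u = 1 + s`. -/
noncomputable def thetaProd : ℤ⟦X⟧⟦X⟧ :=
  qPoch (C (onePlus : ℤ⟦X⟧) * X) X * qPoch (C ((onePlus⁻¹ : ℤ⟦X⟧ˣ) : ℤ⟦X⟧) * X) X

theorem map_C_eulerPhi : map (C (R := ℤ)) eulerPhi = qPoch X X := by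
  rw [eulerPhi, map_C_qPoch _ constantCoeff_X, map_X]

/-- The factor 1 − u⁻¹ is the zeroth factor of (u⁻¹; q)_∞. It has order one in s, so each
coefficient of `thetaProd` is read off one power of s higher. -/
theorem hasSum_triangular_onePlus :
    HasSum (fun j : ℤ => C (((j.negOnePow : ℤ) : ℤ⟦X⟧) * ((onePlus ^ j : ℤ⟦X⟧ˣ) : ℤ⟦X⟧)) * X ^ triangular j)
      (C (1 - ((onePlus⁻¹ : ℤ⟦X⟧ˣ) : ℤ⟦X⟧)) * (thetaProd * map (C (R := ℤ)) eulerPhi)) := by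
  have h := hasSum_thetaTerm_monomial onePlus (α := 1) (β := 0) (by simp) triangular
    (fun j => by rw [two_mul_triangular]; push_cast; ring)
  convert h using 1
  simp only [add_zero, pow_one, pow_zero, mul_one]
  rw [qPoch_eq_one_sub_mul (C ((onePlus⁻¹ : ℤ⟦X⟧ˣ) : ℤ⟦X⟧)) constantCoeff_X, thetaProd, map_C_eulerPhi,
    map_sub, map_one]
  ring

theorem innerCoeff_zero_thetaProd : innerCoeff 0 thetaProd = eulerPhi ^ 2 := by
  have h0 := coeff_zero_onePlus_zpow 1
  have h1 := coeff_zero_onePlus_zpow (-1)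
  rw [zpow_one] at h0
  rw [zpow_neg_one] at h1
  rw [thetaProd, innerCoeff_zero, map_mul, ← innerCoeff_zero, ← innerCoeff_zero,
    innerCoeff_zero_qPoch constantCoeff_X, innerCoeff_zero_qPoch constantCoeff_X]
  simp [innerCoeff_zero, h0, h1, eulerPhi, sq]

theorem negOnePow_neg_one_sub (j : ℤ) : ((-1 - j).negOnePow : ℤ) = -(j.negOnePow : ℤ) := by
  rw [Int.negOnePow_sub]
  simp

theorem triangular_neg_one_sub (j : ℤ) : triangular (-1 - j) = triangular j := by
  have h1 := two_mul_triangular j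
  have h2 := two_mul_triangular (-1 - j)
  zify
  linarith

/-- Coefficients of `(1 - (1 + s)⁻¹) f`. -/
theorem innerCoeff_one_sub_onePlus_inv_mul (f : ℤ⟦X⟧⟦X⟧) :
    innerCoeff 0 (C (1 - ((onePlus⁻¹ : ℤ⟦X⟧ˣ) : ℤ⟦X⟧)) * f) = 0 ∧
    innerCoeff 1 (C (1 - ((onePlus⁻¹ : ℤ⟦X⟧ˣ) : ℤ⟦X⟧)) * f) = innerCoeff 0 f ∧
    innerCoeff 2 (C (1 - ((onePlus⁻¹ : ℤ⟦X⟧ˣ) : ℤ⟦X⟧)) * f) = innerCoeff 1 f - innerCoeff 0 f ∧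
    innerCoeff 3 (C (1 - ((onePlus⁻¹ : ℤ⟦X⟧ˣ) : ℤ⟦X⟧)) * f) =
      innerCoeff 2 f - innerCoeff 1 f + innerCoeff 0 f := by
  obtain ⟨h0, h1, h2, h3⟩ := coeff_onePlus_inv
  refine ⟨?_, ?_, ?_, ?_⟩ <;>
  · simp only [innerCoeff_mul, Nat.sum_antidiagonal_eq_sum_range_succ_mk, sum_range_succ,
      range_zero, sum_empty, innerCoeff_C, map_sub, h0, h1, h2, h3, coeff_one, map_sub]
    simp
    try ring

theorem innerCoeff_mul_map_C (i : ℕ) (f : ℤ⟦X⟧⟦X⟧) (g : ℤ⟦X⟧) :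
    innerCoeff i (f * map (C (R := ℤ)) g) = innerCoeff i f * g := by
  rw [innerCoeff_mul, sum_eq_single (i, 0)]
  · simp [innerCoeff_map_C]
  · rintro ⟨a, b⟩ h hne
    rw [HasAntidiagonal.mem_antidiagonal] at h
    dsimp only at h
    have : b ≠ 0 := by rintro rfl; exact hne (by simp at h; simp [h])
    simp [innerCoeff_map_C, this]
  · simp

/-- **Jacobi's identity** `(q; q)_∞ ^ 3 = ∑_j (-1)^j j q^{j(j+1)/2}`, the sum over all integers. -/
theorem hasSum_eulerPhi_pow_three :
    HasSum (fun j : ℤ => (((j.negOnePow : ℤ) * j : ℤ) : ℤ⟦X⟧) * X ^ triangular j) (eulerPhi ^ 3) := by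
  have h := hasSum_triangular_onePlus.innerCoeff_onePlus (σ := fun j => j) 1
  simp only [coeff_one_onePlus_zpow] at h
  refine h.of_eq (fun _ => rfl) ?_
  rw [(innerCoeff_one_sub_onePlus_inv_mul _).2.1, innerCoeff_mul_map_C, innerCoeff_zero_thetaProd]
  ring

theorem hasSum_negOnePow_triangular :
    HasSum (fun j : ℤ => ((j.negOnePow : ℤ) : ℤ⟦X⟧) * X ^ triangular j) 0 := by
  have h := hasSum_triangular_onePlus.innerCoeff_onePlus (σ := fun j => j) 0
  rw [(innerCoeff_one_sub_onePlus_inv_mul _).1] at h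
  simpa [coeff_zero_onePlus_zpow] using h

theorem hasSum_sq_triangular :
    HasSum (fun j : ℤ => (((j.negOnePow : ℤ) * j ^ 2 : ℤ) : ℤ⟦X⟧) * X ^ triangular j)
      (2 * innerCoeff 1 thetaProd * eulerPhi - eulerPhi ^ 3) := by
  have h := hasSum_triangular_onePlus.innerCoeff_onePlus (σ := fun j => j) 2
  rw [(innerCoeff_one_sub_onePlus_inv_mul _).2.2.1, innerCoeff_mul_map_C, innerCoeff_mul_map_C,
    innerCoeff_zero_thetaProd] at h
  refine ((h.mul_left 2).add hasSum_eulerPhi_pow_three).of_eq (fun j => ?_) ?_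
  · have := coeff_two_onePlus_zpow j
    have : (j.negOnePow : ℤ) * j ^ 2 = 2 * ((j.negOnePow : ℤ) *
        coeff 2 ((onePlus ^ j : ℤ⟦X⟧ˣ) : ℤ⟦X⟧)) + (j.negOnePow : ℤ) * j := by
      linear_combination -(j.negOnePow : ℤ) * this
    rw [this]
    push_cast
    ring
  · ring

/-- The product is invariant under u ↔ u⁻¹, so it has no linear term in s. On the series side the
reflection j ↦ −1 − j preserves the exponent and reverses the sign, and j² − (j + 1)² + 2j + 1 = 0.
-/
theorem innerCoeff_one_thetaProd : innerCoeff 1 thetaProd = 0 := by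
  have h := hasSum_sq_triangular
  have h' := (Equiv.subLeft (-1 : ℤ)).hasSum_iff.mpr h
  have key := ((h.add h').add (hasSum_eulerPhi_pow_three.mul_left 2)).add hasSum_negOnePow_triangular
  have h0 : (fun j : ℤ => (((j.negOnePow : ℤ) * j ^ 2 : ℤ) : ℤ⟦X⟧) * X ^ triangular j +
      ((fun j : ℤ => (((j.negOnePow : ℤ) * j ^ 2 : ℤ) : ℤ⟦X⟧) * X ^ triangular j) ∘
        Equiv.subLeft (-1 : ℤ)) j + 2 * ((((j.negOnePow : ℤ) * j : ℤ) : ℤ⟦X⟧) * X ^ triangular j) +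
      ((j.negOnePow : ℤ) : ℤ⟦X⟧) * X ^ triangular j) = fun _ => 0 := by
    ext1 j
    simp only [Function.comp, Equiv.subLeft_apply, negOnePow_neg_one_sub, triangular_neg_one_sub]
    push_cast
    ring
  rw [h0] at key
  have := key.unique hasSum_zero
  have h4 : (4 : ℤ⟦X⟧) * (innerCoeff 1 thetaProd * eulerPhi) = 0 := by linear_combination this
  have h4' : (4 : ℤ⟦X⟧) ≠ 0 := by norm_num
  exact (mul_eq_zero.mp ((mul_eq_zero.mp h4).resolve_left h4')).resolve_right eulerPhi_ne_zero

/-- A heat equation: q d/dq multiplies the j-th term by j(j + 1)/2, and j²(j + 1) = j(j − 1)(j − 2)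
+ 4j² − 2j expresses the derivative of Jacobi's series through s-coefficients. -/
theorem innerCoeff_two_thetaProd : innerCoeff 2 thetaProd = eulerPhi * qDeriv eulerPhi := by
  have h2 := hasSum_sq_triangular
  rw [innerCoeff_one_thetaProd] at h2
  have h3 := hasSum_triangular_onePlus.innerCoeff_onePlus (σ := fun j => j) 3
  rw [(innerCoeff_one_sub_onePlus_inv_mul _).2.2.2, innerCoeff_mul_map_C, innerCoeff_mul_map_C,
    innerCoeff_mul_map_C, innerCoeff_zero_thetaProd, innerCoeff_one_thetaProd] at h3
  have hD := hasSum_eulerPhi_pow_three.map qDeriv continuous_qDeriv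
  have key := (((hD.mul_left 2).sub (h3.mul_left 6)).sub (h2.mul_left 4)).add
    (hasSum_eulerPhi_pow_three.mul_left 2)
  have h0 : (fun j : ℤ => 2 * (qDeriv ∘ fun j : ℤ =>
        (((j.negOnePow : ℤ) * j : ℤ) : ℤ⟦X⟧) * X ^ triangular j) j -
      6 * ((((j.negOnePow : ℤ) * coeff 3 ((onePlus ^ j : ℤ⟦X⟧ˣ) : ℤ⟦X⟧) : ℤ) : ℤ⟦X⟧) * X ^ triangular j) -
      4 * ((((j.negOnePow : ℤ) * j ^ 2 : ℤ) : ℤ⟦X⟧) * X ^ triangular j) +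
      2 * ((((j.negOnePow : ℤ) * j : ℤ) : ℤ⟦X⟧) * X ^ triangular j)) = fun _ => 0 := by
    ext1 j
    have hT := two_mul_triangular j
    have hc := coeff_three_onePlus_zpow j
    have : 2 * ((triangular j : ℤ) * ((j.negOnePow : ℤ) * j)) - 6 * ((j.negOnePow : ℤ) *
        coeff 3 ((onePlus ^ j : ℤ⟦X⟧ˣ) : ℤ⟦X⟧)) - 4 * ((j.negOnePow : ℤ) * j ^ 2) +
        2 * ((j.negOnePow : ℤ) * j) = 0 := by
      linear_combination (j.negOnePow : ℤ) * j * hT - (j.negOnePow : ℤ) * hc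
    simp only [Function.comp, qDeriv_intCast_mul_X_pow]
    have := congrArg (fun z : ℤ => (z : ℤ⟦X⟧) * X ^ triangular j) this
    push_cast at this ⊢
    linear_combination this
  rw [h0] at key
  have := key.unique hasSum_zero
  rw [qDeriv_pow_succ eulerPhi 2] at this
  push_cast at this
  have h6 : (6 * eulerPhi : ℤ⟦X⟧) * (innerCoeff 2 thetaProd - eulerPhi * qDeriv eulerPhi) = 0 := by
    linear_combination -this
  have h6' : (6 * eulerPhi : ℤ⟦X⟧) ≠ 0 := mul_ne_zero (by norm_num) eulerPhi_ne_zero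
  exact sub_eq_zero.mp ((mul_eq_zero.mp h6).resolve_left h6')

/-! ### The series `cubicTheta` and its square -/

/-- Euler's function `(q^m; q^m)_∞`. -/
noncomputable def eulerAt (m : ℕ) : ℤ⟦X⟧ := qPoch (X ^ m) (X ^ m)

theorem eulerAt_one : eulerAt 1 = eulerPhi := by simp [eulerAt, eulerPhi]

theorem constantCoeff_X_pow {R : Type*} [CommRing R] {m : ℕ} (hm : m ≠ 0) :
    constantCoeff ((X : R⟦X⟧) ^ m) = 0 := by
  rw [map_pow, constantCoeff_X, zero_pow hm]

theorem constantCoeff_eulerAt {m : ℕ} (hm : m ≠ 0) : constantCoeff (eulerAt m) = 1 := by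
  rw [eulerAt, constantCoeff_qPoch _ (constantCoeff_X_pow hm), constantCoeff_X_pow hm, sub_zero]

theorem eulerAt_ne_zero {m : ℕ} (hm : m ≠ 0) : eulerAt m ≠ 0 := fun h => by
  simpa [h] using constantCoeff_eulerAt hm

theorem expand_eulerAt {p m : ℕ} (hp : p ≠ 0) (hm : m ≠ 0) :
    (eulerAt m).expand p hp = eulerAt (p * m) := by
  rw [eulerAt, expand_qPoch p hp _ (constantCoeff_X_pow hm), map_pow, expand_X, ← pow_mul, eulerAt]

theorem expand_eulerPhi {p : ℕ} (hp : p ≠ 0) : eulerPhi.expand p hp = eulerAt p := by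
  rw [← eulerAt_one, expand_eulerAt hp one_ne_zero, mul_one]

theorem map_C_eulerAt {m : ℕ} (hm : m ≠ 0) :
    PowerSeries.map (C (R := ℤ)) (eulerAt m) = qPoch (X ^ m) (X ^ m) := by
  rw [eulerAt, map_C_qPoch _ (constantCoeff_X_pow hm), map_pow, map_X]

theorem qPoch_X_split_three {R : Type*} [CommRing R] [TopologicalSpace R] [IsTopologicalRing R]
    [T2Space R] (c : R⟦X⟧) : qPoch (c * X) X =
      qPoch (c * X) (X ^ 3) * qPoch (c * X ^ 2) (X ^ 3) * qPoch (c * X ^ 3) (X ^ 3) := by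
  rw [qPoch_eq_prod _ constantCoeff_X (three_ne_zero), prod_range_succ, prod_range_succ,
    prod_range_one, pow_zero, mul_one, pow_one, mul_assoc c X X, ← sq, mul_assoc c X (X ^ 2),
    ← pow_succ']

/-- `∑_j (-1)^j u^j q^{j(3j+1)/2}` with `u = 1 + s`, as a product. -/
noncomputable def thetaPlus : ℤ⟦X⟧⟦X⟧ :=
  qPoch (C (onePlus : ℤ⟦X⟧) * X ^ 2) (X ^ 3) *
    qPoch (C ((onePlus⁻¹ : ℤ⟦X⟧ˣ) : ℤ⟦X⟧) * X) (X ^ 3) * qPoch (X ^ 3) (X ^ 3)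

/-- `∑_j (-1)^j u^{-j} q^{j(3j+1)/2}` with `u = 1 + s`, as a product. -/
noncomputable def thetaMinus : ℤ⟦X⟧⟦X⟧ :=
  qPoch (C ((onePlus⁻¹ : ℤ⟦X⟧ˣ) : ℤ⟦X⟧) * X ^ 2) (X ^ 3) *
    qPoch (C (onePlus : ℤ⟦X⟧) * X) (X ^ 3) * qPoch (X ^ 3) (X ^ 3)

theorem hasSum_thetaPlus :
    HasSum (fun j : ℤ => C (((j.negOnePow : ℤ) : ℤ⟦X⟧) * ((onePlus ^ j : ℤ⟦X⟧ˣ) : ℤ⟦X⟧)) *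
      X ^ pentagonalNum j) thetaPlus := by
  have h := hasSum_thetaTerm_monomial onePlus (α := 2) (β := 1) (by simp) pentagonalNum
    (fun j => by rw [two_mul_pentagonalNum]; push_cast; ring)
  rwa [pow_one] at h

theorem hasSum_thetaMinus :
    HasSum (fun j : ℤ => C (((j.negOnePow : ℤ) : ℤ⟦X⟧) * ((onePlus ^ (-j) : ℤ⟦X⟧ˣ) : ℤ⟦X⟧)) *
      X ^ pentagonalNum j) thetaMinus := by
  have h := hasSum_thetaTerm_monomial onePlus⁻¹ (α := 2) (β := 1) (by simp) pentagonalNum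
    (fun j => by rw [two_mul_pentagonalNum]; push_cast; ring)
  rw [pow_one, inv_inv] at h
  exact h.of_eq (fun j => by rw [inv_zpow']) rfl

/-- The factors of `thetaProd` are sorted by n mod 3: the classes 1 and 2 form the two theta
products, the class 0 is `thetaProd` at q³. -/
theorem thetaPlus_mul_thetaMinus :
    thetaPlus * thetaMinus * thetaProd.expand 3 three_ne_zero =
      thetaProd * PowerSeries.map (C (R := ℤ)) (eulerAt 3 ^ 2) := by
  rw [thetaProd, map_mul, expand_qPoch _ _ _ constantCoeff_X, expand_qPoch _ _ _ constantCoeff_X,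
    qPoch_X_split_three, qPoch_X_split_three, map_mul, map_mul, expand_C, expand_C, expand_X, map_pow,
    map_C_eulerAt three_ne_zero, thetaPlus, thetaMinus]
  ring

theorem innerCoeff_expand (i p : ℕ) (hp : p ≠ 0) (f : ℤ⟦X⟧⟦X⟧) :
    innerCoeff i (f.expand p hp) = (innerCoeff i f).expand p hp := by
  ext n
  rw [coeff_innerCoeff, coeff_expand, coeff_expand]
  split_ifs
  · rw [coeff_innerCoeff]
  · simp

theorem innerCoeff_zero_thetaPlus : innerCoeff 0 thetaPlus = eulerPhi := by
  have h0 := coeff_zero_onePlus_zpow 1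
  have h1 := coeff_zero_onePlus_zpow (-1)
  rw [zpow_one] at h0
  rw [zpow_neg_one] at h1
  have h3 : constantCoeff ((X : ℤ⟦X⟧⟦X⟧) ^ 3) = 0 := constantCoeff_X_pow three_ne_zero
  have hE := qPoch_X_split_three (1 : ℤ⟦X⟧)
  simp only [one_mul] at hE
  rw [thetaPlus, innerCoeff_zero, map_mul, map_mul, ← innerCoeff_zero, ← innerCoeff_zero,
    ← innerCoeff_zero, innerCoeff_zero_qPoch h3, innerCoeff_zero_qPoch h3, innerCoeff_zero_qPoch h3,
    eulerPhi, hE]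
  simp only [innerCoeff_zero, map_mul, map_pow, map_X, map_C, h0, h1, map_one, one_mul]
  ring

theorem hasSum_eulerPhi :
    HasSum (fun j : ℤ => ((j.negOnePow : ℤ) : ℤ⟦X⟧) * X ^ pentagonalNum j) eulerPhi := by
  have h := hasSum_thetaPlus.innerCoeff_onePlus (σ := fun j => j) 0
  rw [innerCoeff_zero_thetaPlus] at h
  simpa [coeff_zero_onePlus_zpow] using h

theorem hasSum_innerCoeff_one_thetaPlus :
    HasSum (fun j : ℤ => (((j.negOnePow : ℤ) * j : ℤ) : ℤ⟦X⟧) * X ^ pentagonalNum j)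
      (innerCoeff 1 thetaPlus) := by
  simpa only [coeff_one_onePlus_zpow] using hasSum_thetaPlus.innerCoeff_onePlus (σ := fun j => j) 1

theorem innerCoeff_zero_thetaMinus : innerCoeff 0 thetaMinus = eulerPhi := by
  have h := hasSum_thetaMinus.innerCoeff_onePlus (σ := fun j => -j) 0
  refine h.unique (hasSum_eulerPhi.of_eq (fun j => ?_) rfl)
  rw [coeff_zero_eq_constantCoeff_apply, coeff_zero_onePlus_zpow, mul_one]

theorem innerCoeff_one_thetaMinus : innerCoeff 1 thetaMinus = -innerCoeff 1 thetaPlus := by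
  have h := hasSum_thetaMinus.innerCoeff_onePlus (σ := fun j => -j) 1
  refine h.unique (hasSum_innerCoeff_one_thetaPlus.neg.of_eq (fun j => ?_) rfl)
  rw [coeff_one_onePlus_zpow]
  push_cast
  ring

theorem innerCoeff_two_thetaMinus :
    innerCoeff 2 thetaMinus = innerCoeff 2 thetaPlus + innerCoeff 1 thetaPlus := by
  have h := hasSum_thetaMinus.innerCoeff_onePlus (σ := fun j => -j) 2
  have h2 := hasSum_thetaPlus.innerCoeff_onePlus (σ := fun j => j) 2
  refine h.unique ((h2.add hasSum_innerCoeff_one_thetaPlus).of_eq (fun j => ?_) rfl)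
  have h1 := coeff_two_onePlus_zpow j
  have h2 := coeff_two_onePlus_zpow (-j)
  have : coeff 2 ((onePlus ^ (-j) : ℤ⟦X⟧ˣ) : ℤ⟦X⟧) = coeff 2 ((onePlus ^ j : ℤ⟦X⟧ˣ) : ℤ⟦X⟧) + j := by
    linarith
  rw [this]
  push_cast
  ring

/-- The exponent j(3j + 1)/2 equals 3 C(j, 2) + 2j. -/
theorem qDeriv_eulerPhi :
    qDeriv eulerPhi = 3 * innerCoeff 2 thetaPlus + 2 * innerCoeff 1 thetaPlus := by
  have h := hasSum_eulerPhi.map qDeriv continuous_qDeriv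
  have h2 := hasSum_thetaPlus.innerCoeff_onePlus (σ := fun j => j) 2
  refine h.unique (((h2.mul_left 3).add (hasSum_innerCoeff_one_thetaPlus.mul_left 2)).of_eq
    (fun j => ?_) rfl)
  have h1 := coeff_two_onePlus_zpow j
  have hG := two_mul_pentagonalNum j
  have : (pentagonalNum j : ℤ) = 3 * coeff 2 ((onePlus ^ j : ℤ⟦X⟧ˣ) : ℤ⟦X⟧) + 2 * j := by linarith
  rw [Function.comp, qDeriv_intCast_mul_X_pow, this]
  push_cast
  ring

/-- The series `∑_j (-1)^j (6 j + 1) q^{j(3j+1)/2}`. -/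
noncomputable def cubicTheta : ℤ⟦X⟧ := 6 * innerCoeff 1 thetaPlus + eulerPhi

/-- The square of the weight one theta series `cubicTheta / eulerPhi` as a logarithmic derivative. -/
theorem cubicTheta_sq_mul :
    cubicTheta ^ 2 * eulerAt 3 = 12 * eulerPhi ^ 2 * qDeriv (eulerAt 3) -
      12 * eulerPhi * eulerAt 3 * qDeriv eulerPhi + eulerPhi ^ 2 * eulerAt 3 := by
  have key := congrArg (innerCoeff 2) thetaPlus_mul_thetaMinus
  have hE : qDeriv (eulerAt 3) = 3 * (qDeriv eulerPhi).expand 3 three_ne_zero := by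
    rw [← expand_eulerPhi three_ne_zero, qDeriv_expand]; simp
  rw [innerCoeff_mul_map_C] at key
  simp only [innerCoeff_mul, Nat.sum_antidiagonal_eq_sum_range_succ_mk,
    sum_range_succ, range_zero, sum_empty, innerCoeff_expand, innerCoeff_zero_thetaPlus,
    innerCoeff_zero_thetaMinus, innerCoeff_one_thetaMinus, innerCoeff_two_thetaMinus,
    innerCoeff_zero_thetaProd, innerCoeff_one_thetaProd, innerCoeff_two_thetaProd, map_mul, map_pow,
    expand_eulerPhi, map_zero, Nat.sub_zero, Nat.sub_self, Nat.reduceSub] at key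
  refine mul_left_cancel₀ (eulerAt_ne_zero three_ne_zero) ?_
  have hD := qDeriv_eulerPhi
  rw [cubicTheta, hE]
  -- The s² coefficient contains −t² with t = `innerCoeff 1 thetaPlus`; the factor −36 turns it into
  -- the square of 6t from `cubicTheta`. The second term eliminates `innerCoeff 2 thetaPlus`.
  linear_combination (-36) * key - 24 * eulerPhi * eulerAt 3 ^ 2 * hD

/-! ### Dissection of the cube of Euler's function -/

/-- If `ι` is partitioned into `k` classes, the `r`-th of which is parametrized by `g r`, then a sum
over `ι` is the sum of the `k` sums over the parameters. -/
theorem HasSum.of_classes {ι κ M : Type*} [AddCommMonoid M] [TopologicalSpace M] [ContinuousAdd M]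
    {f : ι → M} {k : ℕ} (c : ι → ℕ) (g : ℕ → κ → ι) (hc : ∀ i, c i < k)
    (hg : ∀ r < k, Function.Injective (g r)) (hcg : ∀ r < k, ∀ m, c (g r m) = r)
    (hgc : ∀ i, i ∈ Set.range (g (c i))) {s : ℕ → M}
    (h : ∀ r < k, HasSum (fun m => f (g r m)) (s r)) : HasSum f (∑ r ∈ range k, s r) := by
  have hr : ∀ r ∈ range k, HasSum (fun i => if c i = r then f i else 0) (s r) := by
    intro r hr
    rw [mem_range] at hr
    refine ((hg r hr).hasSum_iff fun i hi => ?_).mp ((h r hr).of_eq (fun m => ?_) rfl)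
    · refine if_neg fun hir => hi ?_
      rw [← hir]
      exact hgc i
    · exact if_pos (hcg r hr m)
  refine (hasSum_sum hr).of_eq (fun i => ?_) rfl
  rw [sum_ite_eq, if_pos (mem_range.mpr (hc i))]

theorem HasSum.of_residues {M : Type*} [AddCommMonoid M] [TopologicalSpace M] [ContinuousAdd M]
    {f : ℤ → M} {k : ℕ} (hk : k ≠ 0) {s : ℕ → M}
    (h : ∀ r < k, HasSum (fun m : ℤ => f (k * m + r)) (s r)) : HasSum f (∑ r ∈ range k, s r) := by
  have hk' : (0 : ℤ) < k := by positivity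
  refine HasSum.of_classes (fun j : ℤ => (j % (k : ℤ)).toNat) (fun r m => k * m + r) (fun j => ?_)
    (fun r _ a b hab => by simpa [hk] using hab) (fun r hr m => ?_) (fun j => ⟨j / k, ?_⟩) h
  · have := Int.emod_lt_of_pos j hk'
    omega
  · rw [Int.mul_add_emod_self_left, Int.emod_eq_of_lt (by positivity) (by exact_mod_cast hr),
      Int.toNat_natCast]
  · dsimp only
    rw [Int.toNat_of_nonneg (Int.emod_nonneg j hk'.ne'), Int.mul_ediv_add_emod]

theorem HasSum.expand {ι : Type*} {c : ι → ℤ} {e : ι → ℕ} {f : ℤ⟦X⟧}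
    (h : HasSum (fun j => (c j : ℤ⟦X⟧) * X ^ e j) f) (p : ℕ) (hp : p ≠ 0) :
    HasSum (fun j => (c j : ℤ⟦X⟧) * X ^ (p * e j)) (f.expand p hp) := by
  refine (h.map (PowerSeries.expand p hp : ℤ⟦X⟧ →ₐ[ℤ] ℤ⟦X⟧)
    (PowerSeries.continuous_expand p hp)).of_eq (fun j => ?_) rfl
  simp [pow_mul]

theorem negOnePow_three_mul (m : ℤ) : (3 * m).negOnePow = m.negOnePow := by
  rw [show 3 * m = m + 2 * m by ring, Int.negOnePow_add, Int.negOnePow_two_mul, mul_one]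

theorem triangular_three_mul (m : ℤ) : triangular (3 * m) = 3 * pentagonalNum m := by
  have h1 := two_mul_triangular (3 * m)
  have h2 := two_mul_pentagonalNum m
  zify
  linarith

theorem triangular_three_mul_add_one (m : ℤ) : triangular (3 * m + 1) = 9 * triangular m + 1 := by
  have h1 := two_mul_triangular (3 * m + 1)
  have h2 := two_mul_triangular m
  zify
  linarith

/-- The 3-dissection of `(q; q)_∞ ^ 3`. -/
theorem eulerPhi_pow_three_dissection :
    eulerPhi ^ 3 = cubicTheta.expand 3 three_ne_zero - 3 * X * eulerAt 9 ^ 3 := by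
  have h1 := hasSum_innerCoeff_one_thetaPlus.expand 3 three_ne_zero
  have h0 := hasSum_eulerPhi.expand 3 three_ne_zero
  have hJ := hasSum_eulerPhi_pow_three.expand 9 (by norm_num)
  have hJ0 := hasSum_negOnePow_triangular.expand 9 (by norm_num)
  let s : ℕ → ℤ⟦X⟧ := fun r => if r = 0 then 3 * (innerCoeff 1 thetaPlus).expand 3 three_ne_zero else
    if r = 1 then -(X * (3 * (eulerPhi ^ 3).expand 9 (by norm_num) + (0 : ℤ⟦X⟧).expand 9 (by norm_num)))
    else 3 * (innerCoeff 1 thetaPlus).expand 3 three_ne_zero + eulerPhi.expand 3 three_ne_zero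
  have key := HasSum.of_residues (k := 3) three_ne_zero (s := s)
    (f := fun j : ℤ => (((j.negOnePow : ℤ) * j : ℤ) : ℤ⟦X⟧) * X ^ triangular j) ?_
  · have := hasSum_eulerPhi_pow_three.unique key
    rw [this]
    have h6 : (6 : ℤ⟦X⟧).expand 3 three_ne_zero = 6 := map_ofNat _ 6
    simp only [s, sum_range_succ, range_zero, sum_empty, cubicTheta, map_add, map_mul, map_pow,
      map_zero, expand_eulerPhi, h6]
    simp
    ring
  · intro r hr
    interval_cases r
    · refine (h1.mul_left 3).of_eq (fun m => ?_) rfl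
      push_cast
      rw [add_zero, negOnePow_three_mul, triangular_three_mul]
      ring
    · refine (((hJ.mul_left 3).add hJ0).mul_left X).neg.of_eq (fun m => ?_) rfl
      push_cast
      rw [Int.negOnePow_succ, negOnePow_three_mul, triangular_three_mul_add_one]
      push_cast
      ring
    -- The class 2 mod 3 is the mirror image of the class 0 under j ↦ −1 − j.
    · refine (Equiv.subLeft (-1 : ℤ)).hasSum_iff.mp
        (((h1.mul_left 3).add h0).of_eq (fun m => ?_) rfl)
      rw [Function.comp, Equiv.subLeft_apply,
        show ((3 : ℕ) : ℤ) * (-1 - m) + ((2 : ℕ) : ℤ) = -1 - 3 * m by push_cast; ring,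
        negOnePow_neg_one_sub, triangular_neg_one_sub, negOnePow_three_mul, triangular_three_mul]
      push_cast
      ring

/-! ### The cubic relation, by cube roots of unity -/

theorem PowerSeries.expand_injective {R : Type*} [CommRing R] (p : ℕ) (hp : p ≠ 0) :
    Function.Injective (PowerSeries.expand (R := R) p hp) := fun f g h => by
  ext n
  rw [← coeff_expand_mul p hp f, h, coeff_expand_mul]

theorem PowerSeries.rescale_expand_of_pow_eq_one {R : Type*} [CommRing R] {p : ℕ} (hp : p ≠ 0) {w : R}
    (hw : w ^ p = 1) (f : R⟦X⟧) : rescale w (f.expand p hp) = f.expand p hp := by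
  ext n
  rw [coeff_rescale, coeff_expand]
  split_ifs with h
  · obtain ⟨m, rfl⟩ := h
    rw [pow_mul, hw, one_pow, one_mul]
  · rw [mul_zero]

section CubeRoots

variable {R : Type*} [CommRing R] [TopologicalSpace R] [IsTopologicalRing R] [T2Space R]

theorem qPoch_split_three_of_cube {c : R⟦X⟧} (hc : c ^ 3 = 1) :
    qPoch (c * X) (c * X) = qPoch (c * X) (X ^ 3) * qPoch (c ^ 2 * X ^ 2) (X ^ 3) *
      qPoch (X ^ 3) (X ^ 3) := by
  rw [qPoch_eq_prod _ (by simp : constantCoeff (c * X) = 0) (three_ne_zero), prod_range_succ,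
    prod_range_succ, prod_range_one, pow_zero, mul_one, pow_one, ← sq, ← pow_succ', mul_pow, mul_pow,
    hc, one_mul]

/-- Over the three cube roots of unity, the factors 1 − q^n multiply to 1 − q^{3n} if 3 ∤ n and to
(1 − q^n)³ if 3 ∣ n. The product is thus (E_3/E_9) · E_3³. -/
theorem prod_qPoch_cube_roots {w : R⟦X⟧} (hw : 1 + w + w ^ 2 = 0) :
    qPoch X X * qPoch (w * X) (w * X) * qPoch (w ^ 2 * X) (w ^ 2 * X) * qPoch (X ^ 9) (X ^ 9) =
      qPoch (X ^ 3) (X ^ 3) ^ 4 := by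
  have hw3 : w ^ 3 = 1 := by linear_combination (w - 1) * hw
  have hX : constantCoeff ((X : R⟦X⟧) ^ 3) = 0 := constantCoeff_X_pow three_ne_zero
  have h0 := qPoch_split_three_of_cube (one_pow 3 : (1 : R⟦X⟧) ^ 3 = 1)
  have h1 := qPoch_split_three_of_cube hw3
  have h2 := qPoch_split_three_of_cube (c := w ^ 2) (by rw [← pow_mul, mul_comm, pow_mul, hw3, one_pow])
  have h3 := qPoch_eq_prod ((X : R⟦X⟧) ^ 3) hX three_ne_zero
  have e1 := qPoch_mul_cube_roots (X : R⟦X⟧) hX hw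
  have e2 := qPoch_mul_cube_roots ((X : R⟦X⟧) ^ 2) hX hw
  simp only [prod_range_succ, range_zero, prod_empty, one_mul, mul_one, ← pow_mul,
    ← pow_add, one_pow, Nat.reduceMul, Nat.reduceAdd] at h0 h2 h3 e1 e2
  rw [show w ^ 4 = w by linear_combination w * hw3] at h2
  rw [h0, h1, h2, pow_succ _ 3]
  nth_rewrite 5 [h3]
  rw [← e1, ← e2]
  ring

end CubeRoots

/-- The cubic relation between `cubicTheta`, `(q; q)_∞` and `(q³; q³)_∞`. -/
theorem cubicTheta_pow_three_mul :
    cubicTheta ^ 3 * eulerAt 3 ^ 3 = eulerPhi ^ 12 + 27 * X * eulerAt 3 ^ 12 := by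
  obtain ⟨w, hw⟩ : ∃ w : ℂ, 1 + w + w ^ 2 = 0 := by
    obtain ⟨w, hw⟩ := IsAlgClosed.exists_root (1 + Polynomial.X + Polynomial.X ^ 2 : Polynomial ℂ)
      (by
        have : (1 + Polynomial.X + Polynomial.X ^ 2 : Polynomial ℂ).degree = 2 := by compute_degree!
        rw [this]; decide)
    exact ⟨w, by simpa [Polynomial.IsRoot] using hw⟩
  have hw3 : w ^ 3 = 1 := by linear_combination (w - 1) * hw
  let φ : ℤ⟦X⟧ →+* ℂ⟦X⟧ := PowerSeries.map (Int.castRingHom ℂ)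
  have hφc : Continuous φ := PowerSeries.continuous_map _ continuous_of_discreteTopology
  have hφX : φ X = X := map_X _
  have hφ : Function.Injective φ := fun f g h => by
    ext n
    have := congrArg (coeff n) h
    simpa [φ] using this
  have hE : ∀ m, m ≠ 0 → φ (eulerAt m) = qPoch (X ^ m) (X ^ m) := fun m hm => by
    rw [eulerAt, map_qPoch φ hφc _ (constantCoeff_X_pow hm), map_pow, hφX]
  have hE1 : φ eulerPhi = qPoch X X := by simpa [eulerAt_one] using hE 1 one_ne_zero
  have hres : ∀ c : ℂ, rescale c (φ eulerPhi) = qPoch (C c * X) (C c * X) := fun c => by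
    rw [hE1, map_qPoch (rescale c) (PowerSeries.continuous_rescale c) _ constantCoeff_X, rescale_X]
  have hdis : ∀ c : ℂ, c ^ 3 = 1 → qPoch (C c * X) (C c * X) ^ 3 =
      φ (cubicTheta.expand 3 three_ne_zero) - 3 * (C c * X) * φ (eulerAt 9) ^ 3 := by
    intro c hc
    have h := congrArg (fun f => rescale c (φ f)) eulerPhi_pow_three_dissection
    have h9 : eulerAt 9 = (eulerAt 3).expand 3 three_ne_zero := by
      rw [expand_eulerAt three_ne_zero three_ne_zero]
    have hinv : ∀ f : ℤ⟦X⟧, rescale c (φ (f.expand 3 three_ne_zero)) = φ (f.expand 3 three_ne_zero) := by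
      intro f
      rw [show φ (f.expand 3 three_ne_zero) = (φ f).expand 3 three_ne_zero from map_expand _ _ _ _,
        PowerSeries.rescale_expand_of_pow_eq_one three_ne_zero hc]
    simp only [map_sub, map_mul, map_pow, map_ofNat] at h
    rw [hres, hinv, h9, hinv, hφX, rescale_X] at h
    rw [h, h9]
  have hP := prod_qPoch_cube_roots (w := C w) (by rw [← map_one C, ← map_add, ← map_pow, ← map_add, hw, map_zero])
  have d0 := hdis 1 (one_pow 3)
  have d1 := hdis w hw3
  have d2 := hdis (w ^ 2) (by rw [← pow_mul, mul_comm, pow_mul, hw3, one_pow])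
  rw [map_one, one_mul] at d0
  rw [map_pow] at d2
  have hwC : 1 + C w + C w ^ 2 = 0 := by rw [← map_one C, ← map_add, ← map_pow, ← map_add, hw, map_zero]
  -- Inserting the dissection at q, wq and w²q turns the left side into the norm of A(q³) − 3q E_9³,
  -- which is A(q³)³ − 27 q³ E_9⁹. Replacing q³ by q gives the claim.
  have hcube := congrArg (· ^ 3) hP
  simp only [mul_pow, d0, d1, d2, ← hE 9 (by norm_num), ← hE 3 three_ne_zero] at hcube
  have hw3C : C w ^ 3 = 1 := by linear_combination (C w - 1) * hwC
  have hfin : φ (cubicTheta.expand 3 three_ne_zero) ^ 3 * φ (eulerAt 9) ^ 3 =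
      φ (eulerAt 3) ^ 12 + 27 * X ^ 3 * φ (eulerAt 9) ^ 12 := by
    set A := φ (cubicTheta.expand 3 three_ne_zero)
    set B := φ (eulerAt 9)
    have : (A - 3 * X * B ^ 3) * (A - 3 * (C w * X) * B ^ 3) * (A - 3 * (C w ^ 2 * X) * B ^ 3) =
        A ^ 3 - 27 * X ^ 3 * B ^ 9 := by
      linear_combination (-3 * A ^ 2 * X * B ^ 3 + 9 * C w * A * X ^ 2 * B ^ 6) * hwC -
        27 * X ^ 3 * B ^ 9 * hw3C
    rw [this] at hcube
    linear_combination hcube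
  apply PowerSeries.expand_injective 3 three_ne_zero
  apply hφ
  simp only [map_mul, map_pow, map_add, expand_eulerPhi, expand_eulerAt three_ne_zero three_ne_zero,
    expand_X, hφX, Nat.reduceMul]
  have h27 : φ ((27 : ℤ⟦X⟧).expand 3 three_ne_zero) = 27 := by
    rw [show (27 : ℤ⟦X⟧).expand 3 three_ne_zero = 27 from map_ofNat _ 27]
    exact map_ofNat φ 27
  rw [h27, hfin]

/-! ### Divisibility of coefficients along arithmetic progressions -/

section Congruence

theorem PowerSeries.natCast_dvd_iff {k : ℕ} {f : ℤ⟦X⟧} :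
    (k : ℤ⟦X⟧) ∣ f ↔ ∀ n, (k : ℤ) ∣ coeff n f := by
  have hk : (k : ℤ⟦X⟧) = C (k : ℤ) := by simp
  rw [hk]
  constructor
  · rintro ⟨g, rfl⟩ n
    rw [coeff_C_mul]
    exact dvd_mul_right _ _
  · intro h
    choose c hc using h
    refine ⟨mk c, ?_⟩
    ext n
    rw [coeff_C_mul, coeff_mk, hc]

/-- Frobenius is the identity on the coefficients in `ZMod p`, so raising to the power p only
replaces q by q^p. -/
theorem PowerSeries.natCast_dvd_pow_sub_expand (p : ℕ) [hp : Fact p.Prime] (f : ℤ⟦X⟧) :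
    (p : ℤ⟦X⟧) ∣ f ^ p - f.expand p hp.out.ne_zero := by
  rw [PowerSeries.natCast_dvd_iff]
  intro n
  rw [← ZMod.intCast_zmod_eq_zero_iff_dvd]
  let φ : ℤ⟦X⟧ →+* (ZMod p)⟦X⟧ := PowerSeries.map (Int.castRingHom (ZMod p))
  have h1 : φ (f.expand p hp.out.ne_zero) = (φ f).expand p hp.out.ne_zero := map_expand _ _ _ _
  have h2 : PowerSeries.map (frobenius (ZMod p) p) ((φ f).expand p hp.out.ne_zero) = (φ f) ^ p :=
    MvPowerSeries.map_frobenius_expand p hp.out.ne_zero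
  have h3 : φ (f ^ p - f.expand p hp.out.ne_zero) = 0 := by
    rw [map_sub, map_pow, h1, ← h2, ZMod.frobenius_zmod]
    ext; simp
  rw [← eq_intCast (Int.castRingHom (ZMod p)), ← coeff_map]
  exact congrArg (coeff n) h3

theorem natCast_dvd_eulerAt_pow_sub (p : ℕ) [hp : Fact p.Prime] {m : ℕ} (hm : m ≠ 0) :
    (p : ℤ⟦X⟧) ∣ eulerAt m ^ p - eulerAt (p * m) := by
  rw [← expand_eulerAt hp.out.ne_zero hm]
  exact PowerSeries.natCast_dvd_pow_sub_expand p _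

/-- All coefficients of `f` at exponents `m n + r` are divisible by `k`. -/
def CoeffDvd (k m r : ℕ) (f : ℤ⟦X⟧) : Prop := ∀ n, (k : ℤ) ∣ coeff (m * n + r) f

variable {k m r : ℕ} {f g : ℤ⟦X⟧}

theorem CoeffDvd.add (hf : CoeffDvd k m r f) (hg : CoeffDvd k m r g) : CoeffDvd k m r (f + g) :=
  fun n => by rw [map_add]; exact dvd_add (hf n) (hg n)

theorem CoeffDvd.sub (hf : CoeffDvd k m r f) (hg : CoeffDvd k m r g) : CoeffDvd k m r (f - g) :=
  fun n => by rw [map_sub]; exact dvd_sub (hf n) (hg n)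

theorem CoeffDvd.of_dvd (h : (k : ℤ⟦X⟧) ∣ f) : CoeffDvd k m r f :=
  fun _ => PowerSeries.natCast_dvd_iff.mp h _

theorem CoeffDvd.of_dvd_sub (hg : CoeffDvd k m r g) (h : (k : ℤ⟦X⟧) ∣ f - g) : CoeffDvd k m r f := by
  simpa using (CoeffDvd.of_dvd h).add hg

theorem CoeffDvd.expand_mul (hr : r < m) (hf : CoeffDvd k m r f) (g : ℤ⟦X⟧) :
    CoeffDvd k m r (g.expand m (by omega) * f) := fun n => by
  rw [coeff_mul]
  refine dvd_sum fun p hp => ?_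
  rw [HasAntidiagonal.mem_antidiagonal] at hp
  rw [coeff_expand]
  split_ifs with h
  · obtain ⟨a, ha⟩ := h
    have hle : a ≤ n := by
      by_contra! hlt
      have : m * (n + 1) ≤ m * a := Nat.mul_le_mul_left m hlt
      rw [Nat.mul_succ] at this
      omega
    obtain ⟨b, rfl⟩ := Nat.exists_eq_add_of_le hle
    have : p.2 = m * b + r := by
      rw [Nat.mul_add] at hp
      omega
    rw [this]
    exact (hf b).mul_left _
  · simp

theorem exists_mul_eq_one (hg : constantCoeff g = 1) : ∃ g' : ℤ⟦X⟧, g * g' = 1 :=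
  ⟨invOfUnit g 1, mul_invOfUnit _ _ (by simp [hg])⟩

theorem CoeffDvd.of_expand_mul (hr : r < m) (hg : constantCoeff g = 1)
    (h : CoeffDvd k m r (g.expand m (by omega) * f)) : CoeffDvd k m r f := by
  obtain ⟨g', hg'⟩ := exists_mul_eq_one hg
  have := h.expand_mul hr g'
  rwa [← mul_assoc, ← map_mul, mul_comm g', hg', map_one, one_mul] at this

theorem CoeffDvd.X_pow_mul_expand {i l : ℕ} (hl : l ≠ 0) (hlm : l ∣ m) (hi : i < l) (h : r % l ≠ i)
    (g : ℤ⟦X⟧) : CoeffDvd k m r (X ^ i * g.expand l hl) := fun n => by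
  rw [coeff_X_pow_mul']
  split_ifs with h'
  · rw [coeff_expand_of_not_dvd]
    · exact dvd_zero _
    · rintro ⟨b, hb⟩
      obtain ⟨c, rfl⟩ := hlm
      have : (l * c * n + r) % l = i := by
        rw [show l * c * n + r = i + l * b by omega, Nat.add_mul_mod_self_left, Nat.mod_eq_of_lt hi]
      rw [mul_assoc, Nat.mul_add_mod] at this
      exact h this
  · exact dvd_zero _

theorem CoeffDvd.expand {l : ℕ} (hl : l ≠ 0) (hlm : l ∣ m) (h : r % l ≠ 0) (g : ℤ⟦X⟧) :
    CoeffDvd k m r (g.expand l hl) := by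
  simpa using CoeffDvd.X_pow_mul_expand (k := k) hl hlm (Nat.pos_of_ne_zero hl) h g

end Congruence

theorem mk_p33_mul_euler : PowerSeries.mk p33 * (eulerPhi ^ 3 * eulerAt 3 ^ 3) = 1 := by
  have h := mk_p33_mul
  rwa [p33Denom, show qFactorialInf X X = eulerPhi from rfl,
    show qFactorialInf (X ^ 3) (X ^ 3) = eulerAt 3 from rfl] at h

theorem CoeffDvd.p33 {k m r : ℕ} (h : CoeffDvd k m r (PowerSeries.mk _root_.p33)) (n : ℕ) :
    _root_.p33 (m * n + r) ≡ 0 [ZMOD k] := by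
  rw [Int.modEq_zero_iff_dvd]
  simpa using h n

/-! ### Moduli 3, 9 and 27 -/

section ModThree

theorem three_dvd_eulerPhi_pow_three_sub : (3 : ℤ⟦X⟧) ∣ eulerPhi ^ 3 - eulerAt 3 := by
  have := natCast_dvd_eulerAt_pow_sub 3 one_ne_zero
  simpa [eulerAt_one] using this

theorem nine_dvd_eulerPhi_pow_nine_sub : (9 : ℤ⟦X⟧) ∣ eulerPhi ^ 9 - eulerAt 3 ^ 3 := by
  have := dvd_sub_pow_of_dvd_sub (p := 3) (by exact_mod_cast three_dvd_eulerPhi_pow_three_sub) 1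
  norm_num [← pow_mul] at this
  exact this

theorem twentySeven_dvd_eulerPhi_pow_sub : (27 : ℤ⟦X⟧) ∣ eulerPhi ^ 27 - eulerAt 3 ^ 9 := by
  have := dvd_sub_pow_of_dvd_sub (p := 3) (by exact_mod_cast three_dvd_eulerPhi_pow_three_sub) 2
  norm_num [← pow_mul] at this
  exact this

/-- P E_3⁴ ≡ P E_1³ E_3³ = 1 mod 3. -/
theorem coeffDvd_three_p33 : CoeffDvd 3 3 1 (PowerSeries.mk p33) := by
  refine CoeffDvd.of_expand_mul (g := eulerPhi ^ 4) (by norm_num) (by simp [constantCoeff_eulerPhi]) ?_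
  rw [map_pow, expand_eulerPhi]
  refine CoeffDvd.of_dvd_sub (g := (1 : ℤ⟦X⟧).expand 3 three_ne_zero)
    (CoeffDvd.expand three_ne_zero (dvd_refl 3) (by norm_num) _) ?_
  have h := three_dvd_eulerPhi_pow_three_sub.mul_left (-(PowerSeries.mk p33 * eulerAt 3 ^ 3))
  rw [map_one]
  convert h using 1
  · norm_num
  · linear_combination mk_p33_mul_euler

theorem expand_three_eulerAt_three : eulerAt 9 = (eulerAt 3).expand 3 three_ne_zero := by
  rw [expand_eulerAt three_ne_zero three_ne_zero]

/-- P E_3⁶ ≡ E_1⁶ mod 9, and in the square of the dissection the q² term carries the factor 9. -/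
theorem coeffDvd_nine_p33 : CoeffDvd 9 3 2 (PowerSeries.mk p33) := by
  refine CoeffDvd.of_expand_mul (g := eulerPhi ^ 6) (by norm_num) (by simp [constantCoeff_eulerPhi]) ?_
  rw [map_pow, expand_eulerPhi]
  refine CoeffDvd.of_dvd_sub (g := (cubicTheta ^ 2).expand 3 three_ne_zero +
      X ^ 1 * (-6 * cubicTheta * eulerAt 3 ^ 3).expand 3 three_ne_zero)
    ((CoeffDvd.expand three_ne_zero (dvd_refl 3) (by norm_num) _).add
      (CoeffDvd.X_pow_mul_expand three_ne_zero (dvd_refl 3) (by norm_num) (by norm_num) _)) ?_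
  have h := nine_dvd_eulerPhi_pow_nine_sub.mul_left (-(PowerSeries.mk p33 * eulerAt 3 ^ 3))
  have hD := eulerPhi_pow_three_dissection
  rw [expand_three_eulerAt_three] at hD
  simp only [map_mul, map_pow, map_neg, map_ofNat]
  push_cast
  set A := cubicTheta.expand 3 three_ne_zero
  set B := (eulerAt 3).expand 3 three_ne_zero
  convert dvd_add h (dvd_mul_right (9 : ℤ⟦X⟧) (X ^ 2 * B ^ 6)) using 1
  linear_combination eulerPhi ^ 6 * mk_p33_mul_euler + (eulerPhi ^ 3 + A - 3 * X * B ^ 3) * hD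

/-- P E_3¹² ≡ E_1²⁴ mod 27, the eighth power of the dissection. Its exponents 2 mod 3 come, mod 27,
from 252 q² A(q³)⁶ E_9⁶; as 252 = 9 · 28, only the cofactor mod 3 matters. There A(q³) ≡ E_3 and E_9
≡ E_3³, so E_3¹² cancels and 9 q² E_9⁴ remains, supported on exponents 2 mod 9. -/
theorem exists_mk_p33_dissection : ∃ a b c e : ℤ⟦X⟧, PowerSeries.mk p33 =
    a.expand 3 three_ne_zero + X ^ 1 * b.expand 3 three_ne_zero +
      X ^ 2 * (9 * c.expand 9 (by norm_num)) + 27 * e := by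
  obtain ⟨v, hv⟩ := exists_mul_eq_one (g := eulerPhi ^ 12) (by simp [constantCoeff_eulerPhi])
  obtain ⟨e₁, he₁⟩ := twentySeven_dvd_eulerPhi_pow_sub
  obtain ⟨e₂, he₂⟩ := three_dvd_eulerPhi_pow_three_sub
  have hv3 := congrArg (PowerSeries.expand 3 three_ne_zero) hv
  rw [map_mul, map_pow, expand_eulerPhi, map_one] at hv3
  have he3 := congrArg (PowerSeries.expand 3 three_ne_zero) he₂
  rw [map_sub, map_pow, expand_eulerPhi, expand_eulerAt _ three_ne_zero, map_mul,
    show (3 : ℤ⟦X⟧).expand 3 three_ne_zero = 3 from map_ofNat _ 3] at he3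
  have hD := eulerPhi_pow_three_dissection
  have hP := mk_p33_mul_euler
  set P := PowerSeries.mk p33
  set V := v.expand 3 three_ne_zero
  set A := cubicTheta.expand 3 three_ne_zero with hA
  set E₃ := eulerAt 3 with hE3
  set B := eulerAt 9 with hB
  have hB3 : B = E₃.expand 3 three_ne_zero := expand_three_eulerAt_three
  -- `P E₃^12` modulo 27
  have h1 : ∃ e, P * E₃ ^ 12 = (A - 3 * X * B ^ 3) ^ 8 + 27 * e := by
    refine ⟨-(P * E₃ ^ 3 * e₁), ?_⟩
    rw [← hD]
    linear_combination eulerPhi ^ 24 * hP - P * E₃ ^ 3 * he₁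
  obtain ⟨e₃, h1⟩ := h1
  have hAE : (3 : ℤ⟦X⟧) ∣ A - E₃ := ⟨e₂ + X * B ^ 3, by linear_combination he₂ - hD⟩
  have hBE : (3 : ℤ⟦X⟧) ∣ B - E₃ ^ 3 := ⟨-(e₂.expand 3 three_ne_zero), by linear_combination -he3⟩
  have h2 : (3 : ℤ⟦X⟧) ∣ A ^ 6 * B ^ 6 - E₃ ^ 12 * B ^ 4 := by
    have hA6 := hAE.trans (sub_dvd_pow_sub_pow A E₃ 6)
    have hB2 := hBE.trans (sub_dvd_pow_sub_pow B (E₃ ^ 3) 2)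
    convert (hA6.mul_sub_mul hB2).mul_right (B ^ 4) using 1
    ring
  obtain ⟨e₄, h2⟩ := h2
  have hpoly : (A - 3 * X * B ^ 3) ^ 8 = A ^ 8 - 24 * X * A ^ 7 * B ^ 3 + 252 * X ^ 2 * A ^ 6 * B ^ 6 +
      27 * (-56 * A ^ 5 * (X * B ^ 3) ^ 3 + 210 * A ^ 4 * (X * B ^ 3) ^ 4 - 504 * A ^ 3 * (X * B ^ 3) ^ 5 +
        756 * A ^ 2 * (X * B ^ 3) ^ 6 - 648 * A * (X * B ^ 3) ^ 7 + 243 * (X * B ^ 3) ^ 8) := by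
    ring
  refine ⟨v * cubicTheta ^ 8, v * (-24) * cubicTheta ^ 7 * eulerAt 3 ^ 3, eulerPhi ^ 4,
    V * (e₃ + X ^ 2 * (e₄ + 9 * (A ^ 6 * B ^ 6)) + (-56 * A ^ 5 * (X * B ^ 3) ^ 3 +
      210 * A ^ 4 * (X * B ^ 3) ^ 4 - 504 * A ^ 3 * (X * B ^ 3) ^ 5 +
      756 * A ^ 2 * (X * B ^ 3) ^ 6 - 648 * A * (X * B ^ 3) ^ 7 + 243 * (X * B ^ 3) ^ 8)), ?_⟩
  simp only [map_mul, map_pow, map_neg, map_ofNat, expand_eulerPhi]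
  rw [← hE3, ← hA, ← hB3, ← hB]
  linear_combination V * h1 + V * hpoly + 9 * X ^ 2 * V * h2 - P * hv3 + 9 * X ^ 2 * B ^ 4 * hv3

theorem coeffDvd_twentySeven_p33 {r : ℕ} (hr : r = 5 ∨ r = 8) : CoeffDvd 27 9 r (PowerSeries.mk p33) := by
  obtain ⟨a, b, c, e, h⟩ := exists_mk_p33_dissection
  have h3 : (3 : ℕ) ∣ 9 := by norm_num
  rw [h]
  refine CoeffDvd.add (CoeffDvd.add (CoeffDvd.add ?_ ?_) ?_) ?_
  · exact CoeffDvd.expand three_ne_zero h3 (by rcases hr with rfl | rfl <;> norm_num) _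
  · exact CoeffDvd.X_pow_mul_expand three_ne_zero h3 (by norm_num)
      (by rcases hr with rfl | rfl <;> norm_num) _
  · have := CoeffDvd.X_pow_mul_expand (k := 27) (m := 9) (r := r) (i := 2) (l := 9) (by norm_num)
      (dvd_refl 9) (by norm_num) (by rcases hr with rfl | rfl <;> norm_num) (9 * c)
    rwa [map_mul, map_ofNat] at this
  · exact CoeffDvd.of_dvd (by exact_mod_cast dvd_mul_right (27 : ℤ⟦X⟧) e)

end ModThree

/-! ### Modulus 5 -/

section ModFive

instance fact_prime_five : Fact (Nat.Prime 5) := ⟨by norm_num⟩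

theorem coeffDvd_five_eulerPhi_sq_mul : CoeffDvd 5 5 3 (eulerPhi ^ 2 * eulerAt 3 ^ 2) := by
  obtain ⟨v, hv⟩ := exists_mul_eq_one (constantCoeff_eulerAt three_ne_zero)
  have hv0 : constantCoeff v = 1 := by
    have := congrArg (constantCoeff (R := ℤ)) hv
    rwa [map_mul, constantCoeff_eulerAt three_ne_zero, one_mul, map_one] at this
  have hA0 : constantCoeff cubicTheta = 1 := by
    have := congrArg (constantCoeff (R := ℤ)) eulerPhi_pow_three_dissection
    simpa [constantCoeff_eulerPhi] using this.symm
  have hdv : qDeriv v = -v ^ 2 * qDeriv (eulerAt 3) := by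
    have h1 : qDeriv (1 : ℤ⟦X⟧) = 0 := by ext n; rw [coeff_qDeriv, coeff_one]; split_ifs <;> simp [*]
    have := congrArg qDeriv hv
    rw [qDeriv_mul, h1] at this
    linear_combination v * this - qDeriv v * hv
  have hw := qDeriv_mul (eulerPhi ^ 4) (v ^ 4)
  rw [qDeriv_pow_succ, qDeriv_pow_succ, hdv] at hw
  have hw4 := qDeriv_pow_succ (eulerPhi ^ 4 * v ^ 4) 3
  have hXw := qDeriv_mul X (eulerPhi ^ 4 * v ^ 4)
  rw [qDeriv_X] at hXw
  push_cast at hw hw4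
  have h2 := cubicTheta_sq_mul
  have h3 := cubicTheta_pow_three_mul
  set w := eulerPhi ^ 4 * v ^ 4 with hwdef
  set z := cubicTheta * v ^ 3 with hz
  set F := eulerPhi ^ 2 * eulerAt 3 ^ 2
  have hvp : ∀ n, eulerAt 3 ^ n * v ^ n = 1 := fun n => by rw [← mul_pow, hv, one_pow]
  have hz3 : z ^ 3 = w ^ 3 + 27 * X := by
    rw [hz, hwdef]
    linear_combination v ^ 12 * h3 - cubicTheta ^ 3 * v ^ 9 * hvp 3 + 27 * X * hvp 12
  have hFz : F * z ^ 2 = w - 3 * qDeriv w := by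
    rw [hw, hwdef, hz]
    linear_combination eulerPhi ^ 2 * v ^ 5 * h2 +
      (eulerPhi ^ 2 * cubicTheta ^ 2 * v ^ 4) * hvp 2 +
      (-eulerPhi ^ 2 * cubicTheta ^ 2 * v ^ 4 - 12 * eulerPhi ^ 3 * v ^ 4 * qDeriv eulerPhi +
        eulerPhi ^ 4 * v ^ 4) * hv
  -- The constant 108 makes (w³ + 27q)(w − 3 q dw/dq) the image of one series under 4 − 3 q d/dq, up
  -- to the factor 4.
  have h5 : 4 * (F * z ^ 5) = 4 * (w ^ 4 + 108 * (X * w)) - 3 * qDeriv (w ^ 4 + 108 * (X * w)) := by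
    have h108 : qDeriv (108 * (X * w)) = 108 * qDeriv (X * w) := by
      have := map_nsmul qDeriv 108 (X * w)
      simpa [nsmul_eq_mul] using this
    rw [map_add, h108, hw4, hXw]
    linear_combination 4 * F * z ^ 2 * hz3 + 4 * (w ^ 3 + 27 * X) * hFz
  refine CoeffDvd.of_expand_mul (g := z) (by norm_num) (by simp [hz, hA0, hv0]) ?_
  have hmain : CoeffDvd 5 5 3 (F * z ^ 5) := fun n => by
    have := congrArg (coeff (5 * n + 3)) h5
    rw [map_sub] at this
    have e4 : (4 : ℤ⟦X⟧) = ((4 : ℤ) : ℤ⟦X⟧) := by norm_num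
    have e3 : (3 : ℤ⟦X⟧) = ((3 : ℤ) : ℤ⟦X⟧) := by norm_num
    rw [e4, e3, PowerSeries.coeff_intCast_mul, PowerSeries.coeff_intCast_mul,
      PowerSeries.coeff_intCast_mul, coeff_qDeriv] at this
    push_cast at this ⊢
    generalize coeff (5 * n + 3) (w ^ 4 + 108 * (X * w)) = t at this
    -- At exponent 5n + 3 the operator acts by 4 − 3(5n + 3) = −5(3n + 1); writing y = 5y − 4y
    -- removes the factor 4.
    have h' : coeff (5 * n + 3) (F * z ^ 5) =
        5 * (coeff (5 * n + 3) (F * z ^ 5) + (3 * n + 1) * t) := by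
      linear_combination -this
    rw [h']
    exact dvd_mul_right _ _
  refine hmain.of_dvd_sub ?_
  have := (PowerSeries.natCast_dvd_pow_sub_expand 5 z).mul_left (-F)
  convert this using 1
  ring

theorem coeffDvd_five_p33 : CoeffDvd 5 5 3 (PowerSeries.mk p33) := by
  refine CoeffDvd.of_expand_mul (g := eulerPhi * eulerAt 3) (by norm_num)
    (by simp [constantCoeff_eulerPhi, constantCoeff_eulerAt]) ?_
  refine coeffDvd_five_eulerPhi_sq_mul.of_dvd_sub ?_
  have := (PowerSeries.natCast_dvd_pow_sub_expand 5 (eulerPhi * eulerAt 3)).mul_left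
    (-PowerSeries.mk p33)
  convert this using 1
  linear_combination eulerPhi ^ 2 * eulerAt 3 ^ 2 * mk_p33_mul_euler

end ModFive

/-! ### The theta functions φ and ψ modulo 2 and 4 -/

/-- Since ℤ is discrete, each coefficient of the sum equals that of some finite partial sum. -/
theorem HasSum.natCast_dvd {ι : Type*} {f : ι → ℤ⟦X⟧} {a : ℤ⟦X⟧} (h : HasSum f a) {k : ℕ}
    (hk : ∀ i, (k : ℤ⟦X⟧) ∣ f i) : (k : ℤ⟦X⟧) ∣ a := by
  rw [PowerSeries.natCast_dvd_iff]
  intro n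
  have hn := (PowerSeries.WithPiTopology.hasSum_iff_hasSum_coeff ℤ).mp h n
  have := hn.eventually_mem (s := {coeff n a}) (by simp)
  obtain ⟨s, hs⟩ := this.exists
  rw [Set.mem_singleton_iff] at hs
  rw [← hs]
  exact dvd_sum fun i _ => PowerSeries.natCast_dvd_iff.mp (hk i) n

/-- `ψ(q) = ∑_{n ≥ 0} q^{n(n+1)/2}`, as a product. -/
noncomputable def psiSeries : ℤ⟦X⟧ := qPoch (-X) X ^ 2 * eulerPhi

/-- `φ(q) = ∑_j q^{j²}`, as a product. -/
noncomputable def phiSeries : ℤ⟦X⟧ := qPoch (-X) (X ^ 2) ^ 2 * eulerAt 2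

theorem hasSum_psiSeries : HasSum (fun j : ℤ => ((1 : ℤ) : ℤ⟦X⟧) * X ^ triangular j) (2 * psiSeries) := by
  have h := hasSum_thetaTerm_monomial (-1 : ℤˣ) (α := 1) (β := 0) (by simp) triangular
    (fun j => by rw [two_mul_triangular]; push_cast; ring)
  refine h.of_eq (fun j => ?_) ?_
  · rw [Int.cast_id, ← Int.negOnePow_def, ← Units.val_mul, ← Int.negOnePow_add, ← two_mul,
      Int.negOnePow_two_mul]
    simp
  · simp only [add_zero, pow_one, pow_zero, inv_neg, inv_one, Units.val_neg, Units.val_one, map_neg,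
      map_one, neg_mul, one_mul]
    rw [qPoch_eq_one_sub_mul (-1) constantCoeff_X, neg_one_mul, psiSeries, eulerPhi]
    ring

theorem hasSum_phiSeries : HasSum (fun j : ℤ => ((1 : ℤ) : ℤ⟦X⟧) * X ^ (j.natAbs ^ 2)) phiSeries := by
  have h := hasSum_thetaTerm_monomial (-1 : ℤˣ) (α := 1) (β := 1) (by simp) (fun j => j.natAbs ^ 2)
    (fun j => by push_cast; rw [sq_abs]; ring)
  refine h.of_eq (fun j => ?_) ?_
  · rw [Int.cast_id, ← Int.negOnePow_def, ← Units.val_mul, ← Int.negOnePow_add, ← two_mul,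
      Int.negOnePow_two_mul]
    simp
  · simp only [pow_one, inv_neg, inv_one, Units.val_neg, Units.val_one, map_neg, map_one, neg_mul,
      one_mul, Nat.reduceAdd]
    rw [phiSeries, eulerAt]
    ring

/-- The alternating version of `φ(q)`. -/
theorem hasSum_phiSeries_alternating :
    HasSum (fun j : ℤ => ((j.negOnePow : ℤ) : ℤ⟦X⟧) * X ^ (j.natAbs ^ 2))
      (qPoch X (X ^ 2) ^ 2 * eulerAt 2) := by
  have h := hasSum_thetaTerm_monomial (1 : ℤˣ) (α := 1) (β := 1) (by simp) (fun j => j.natAbs ^ 2)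
    (fun j => by push_cast; rw [sq_abs]; ring)
  refine h.of_eq (fun j => ?_) ?_
  · simp
  · simp only [pow_one, inv_one, Units.val_one, map_one, one_mul, Nat.reduceAdd]
    rw [eulerAt]
    ring

theorem eulerPhi_eq_qPoch_mul : eulerPhi = qPoch X (X ^ 2) * eulerAt 2 := by
  rw [eulerPhi, qPoch_eq_prod _ constantCoeff_X two_ne_zero, prod_range_succ, prod_range_one, eulerAt]
  ring_nf

theorem two_dvd_phiSeries_sub_one : (2 : ℤ⟦X⟧) ∣ phiSeries - 1 := by
  have h := hasSum_phiSeries.nat_add_neg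
  have := h.natCast_dvd (k := 2) (fun n => by
    refine ⟨X ^ (n ^ 2), ?_⟩
    simp [two_mul])
  push_cast at this
  -- Pairing j with −j counts j = 0 twice, so the paired sum is φ + 1; subtracting 2 corrects it.
  have h2 := dvd_sub this (dvd_refl (2 : ℤ⟦X⟧))
  convert h2 using 1
  rw [one_mul, pow_zero]
  ring

/-- The subtracted product is φ(−q). The terms j and −j of the difference together give 2(1 −
(−1)^j), which is 0 or 4. -/
theorem four_dvd_phiSeries_sub : (4 : ℤ⟦X⟧) ∣ phiSeries - qPoch X (X ^ 2) ^ 2 * eulerAt 2 := by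
  have h := (hasSum_phiSeries.sub hasSum_phiSeries_alternating).nat_add_neg
  have := h.natCast_dvd (k := 4) (fun n => by
    have hn : (2 : ℤ⟦X⟧) ∣ 1 - (((n : ℤ).negOnePow : ℤ) : ℤ⟦X⟧) := by
      have : (2 : ℤ) ∣ 1 - ((n : ℤ).negOnePow : ℤ) := by
        rcases Int.even_or_odd (n : ℤ) with he | ho
        · simp [Int.negOnePow_even _ he]
        · simp [Int.negOnePow_odd _ ho]
      have := map_dvd (Int.castRingHom ℤ⟦X⟧) this
      simpa only [map_sub, map_one, map_ofNat, eq_intCast] using this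
    obtain ⟨c, hc⟩ := hn
    refine ⟨c * X ^ (n ^ 2), ?_⟩
    rw [Int.negOnePow_neg, Int.natAbs_neg, Int.natAbs_natCast]
    push_cast at hc ⊢
    linear_combination (2 * X ^ (n ^ 2)) * hc)
  simpa using this

/-- Pairing n with −1 − n in 2E_1³ − 2ψ gives 2((−1)^n (2n + 1) − 1), and (−1)^n (2n + 1) ≡ 1 mod 4.
-/
theorem four_dvd_eulerPhi_pow_three_sub_psiSeries : (4 : ℤ⟦X⟧) ∣ eulerPhi ^ 3 - psiSeries := by
  have h := ((hasSum_eulerPhi_pow_three.mul_left 2).sub hasSum_psiSeries).nat_add_neg_add_one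
  have := h.natCast_dvd (k := 8) (fun n => by
    have hn : (4 : ℤ) ∣ ((n : ℤ).negOnePow : ℤ) * (2 * n + 1) - 1 := by
      rcases Int.even_or_odd (n : ℤ) with he | ho
      · rw [Int.negOnePow_even _ he]
        obtain ⟨m, hm⟩ := he
        exact ⟨m, by push_cast; linarith⟩
      · rw [Int.negOnePow_odd _ ho]
        obtain ⟨m, hm⟩ := ho
        exact ⟨-m - 1, by push_cast; linarith⟩
    obtain ⟨c, hc⟩ := hn
    refine ⟨(c : ℤ⟦X⟧) * X ^ triangular n, ?_⟩
    have hc' := congrArg (fun z : ℤ => (z : ℤ⟦X⟧)) hc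
    rw [show -((n : ℤ) + 1) = -1 - n by ring, negOnePow_neg_one_sub, triangular_neg_one_sub]
    push_cast at hc' ⊢
    linear_combination (2 * X ^ triangular (n : ℤ)) * hc')
  obtain ⟨c, hc⟩ := this
  refine ⟨c, mul_left_cancel₀ (two_ne_zero (α := ℤ⟦X⟧)) ?_⟩
  push_cast at hc
  linear_combination hc

/-! ### The product ψ(q)ψ(q³) -/

/-- The growth bounds leave finitely many pairs for each exponent, which makes the double series
summable. -/
theorem hasSum_mul_of_natAbs_le {e e' : ℤ → ℕ} {f g : ℤ⟦X⟧} (he : ∀ j, j.natAbs ≤ e j + 1)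
    (he' : ∀ j, j.natAbs ≤ e' j + 1) (hf : HasSum (fun j => ((1 : ℤ) : ℤ⟦X⟧) * X ^ e j) f)
    (hg : HasSum (fun j => ((1 : ℤ) : ℤ⟦X⟧) * X ^ e' j) g) :
    HasSum (fun p : ℤ × ℤ => (X : ℤ⟦X⟧) ^ (e p.1 + e' p.2)) (f * g) := by
  have key : ∀ p : ℤ × ℤ, ((1 : ℤ) : ℤ⟦X⟧) * X ^ e p.1 * (((1 : ℤ) : ℤ⟦X⟧) * X ^ e' p.2) =
      X ^ (e p.1 + e' p.2) := fun p => by push_cast; ring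
  have hs : Summable fun p : ℤ × ℤ =>
      ((1 : ℤ) : ℤ⟦X⟧) * X ^ e p.1 * (((1 : ℤ) : ℤ⟦X⟧) * X ^ e' p.2) := by
    simp only [key]
    rw [PowerSeries.WithPiTopology.summable_iff_summable_coeff]
    intro d
    refine summable_of_hasFiniteSupport (Set.Finite.subset
      ((Set.finite_Icc (-(d + 1) : ℤ) (d + 1)).prod (Set.finite_Icc (-(d + 1) : ℤ) (d + 1))) ?_)
    rintro ⟨j, k⟩ h
    simp only [Function.mem_support, coeff_X_pow, ne_eq, ite_eq_right_iff, one_ne_zero, imp_false,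
      not_not] at h
    have h1 := he j
    have h2 := he' k
    simp only [Set.mem_prod, Set.mem_Icc]
    omega
  exact (hf.mul hg hs).of_eq (fun p => (key p).symm) rfl

theorem natAbs_le_triangular (j : ℤ) : j.natAbs ≤ triangular j + 1 := by
  have := two_mul_triangular j
  zify
  rcases abs_cases j with ⟨h, _⟩ | ⟨h, _⟩ <;> rw [h] <;> nlinarith [sq_nonneg (2 * j - 1), sq_nonneg (2 * j + 3)]

theorem natAbs_le_natAbs_sq (j : ℤ) : j.natAbs ≤ j.natAbs ^ 2 + 1 :=
  (Nat.le_self_pow two_ne_zero _).trans (Nat.le_succ _)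

theorem natAbs_le_mul {e : ℤ → ℕ} (he : ∀ j, j.natAbs ≤ e j + 1) {p : ℕ} (hp : p ≠ 0) (j : ℤ) :
    j.natAbs ≤ p * e j + 1 :=
  (he j).trans (Nat.succ_le_succ (Nat.le_mul_of_pos_left _ (Nat.pos_of_ne_zero hp)))

/-- `ψ(q) ψ(q³) = φ(q⁶) ψ(q⁴) + q φ(q²) ψ(q¹²)`. -/
theorem psiSeries_mul_expand :
    psiSeries * psiSeries.expand 3 three_ne_zero =
      phiSeries.expand 6 (by norm_num) * psiSeries.expand 4 four_ne_zero +
        X * (phiSeries.expand 2 two_ne_zero * psiSeries.expand 12 (by norm_num)) := by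
  have hL := hasSum_mul_of_natAbs_le natAbs_le_triangular
    (natAbs_le_mul natAbs_le_triangular three_ne_zero) hasSum_psiSeries
    (hasSum_psiSeries.expand 3 three_ne_zero)
  have h0 := hasSum_mul_of_natAbs_le (natAbs_le_mul natAbs_le_triangular four_ne_zero)
    (natAbs_le_mul natAbs_le_natAbs_sq (p := 6) (by norm_num)) (hasSum_psiSeries.expand 4 four_ne_zero)
    (hasSum_phiSeries.expand 6 (by norm_num))
  have h1 := (hasSum_mul_of_natAbs_le (natAbs_le_mul natAbs_le_natAbs_sq two_ne_zero)
    (natAbs_le_mul natAbs_le_triangular (p := 12) (by norm_num)) (hasSum_phiSeries.expand 2 two_ne_zero)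
    (hasSum_psiSeries.expand 12 (by norm_num))).mul_left X
  set s0 : ℤ⟦X⟧ := (2 * psiSeries).expand 4 four_ne_zero * phiSeries.expand 6 (by norm_num)
  set s1 : ℤ⟦X⟧ := X * (phiSeries.expand 2 two_ne_zero * (2 * psiSeries).expand 12 (by norm_num))
  -- The substitution j = a + 3b, k = a − b diagonalizes j² + 3k² as 4a² + 12b² and covers j − k ≡ 0
  -- mod 4; a shift covers j − k ≡ 2. The reflection j ↦ −1 − j carries these two classes onto the
  -- pairs with j − k odd.
  let c : ℤ × ℤ → ℕ := fun p => if (p.1 - p.2) % 4 = 0 then 0 else if (p.1 - p.2) % 4 = 2 then 1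
    else if (p.1 + p.2) % 4 = 3 then 2 else 3
  let g : ℕ → ℤ × ℤ → ℤ × ℤ := fun r p => if r = 0 then (p.1 + 3 * p.2, p.1 - p.2) else
    if r = 1 then (p.1 + 3 * p.2 + 1, p.1 - p.2 - 1) else
    if r = 2 then (-1 - (p.1 + 3 * p.2), p.1 - p.2) else (-1 - (p.1 + 3 * p.2 + 1), p.1 - p.2 - 1)
  have e0 : ∀ a b : ℤ, triangular (a + 3 * b) + 3 * triangular (a - b) =
      4 * triangular a + 6 * b.natAbs ^ 2 := fun a b => by
    have i1 := two_mul_triangular (a + 3 * b)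
    have i2 := two_mul_triangular (a - b)
    have i3 := two_mul_triangular a
    zify
    rw [sq_abs]
    linarith
  have e1 : ∀ a b : ℤ, triangular (a + 3 * b + 1) + 3 * triangular (a - b - 1) =
      2 * a.natAbs ^ 2 + 12 * triangular b + 1 := fun a b => by
    have i1 := two_mul_triangular (a + 3 * b + 1)
    have i2 := two_mul_triangular (a - b - 1)
    have i3 := two_mul_triangular b
    zify
    rw [sq_abs]
    linarith
  have key := HasSum.of_classes (k := 4) c g (s := fun r => if r % 2 = 0 then s0 else s1)
    (f := fun p : ℤ × ℤ => (X : ℤ⟦X⟧) ^ (triangular p.1 + 3 * triangular p.2)) ?_ ?_ ?_ ?_ ?_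
  · have := hL.unique key
    simp only [sum_range_succ, range_zero, sum_empty, s0, s1, map_mul, map_ofNat] at this
    norm_num at this
    refine mul_left_cancel₀ (by norm_num : (4 : ℤ⟦X⟧) ≠ 0) ?_
    linear_combination this
  · intro p
    simp only [c]
    split_ifs <;> omega
  · intro r hr ⟨a, b⟩ ⟨a', b'⟩ h
    interval_cases r <;> simp [g] at h ⊢ <;> omega
  · rintro r hr ⟨a, b⟩
    interval_cases r <;> simp only [c, g] <;> norm_num <;> first | omega | (split_ifs <;> omega)
  · rintro ⟨j, k⟩
    by_cases c0 : (j - k) % 4 = 0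
    · exact ⟨(k + (j - k) / 4, (j - k) / 4), by ext <;> simp only [c, g, c0] <;> norm_num; omega⟩
    by_cases c1 : (j - k) % 4 = 2
    · exact ⟨(k + (j - k) / 4 + 1, (j - k) / 4), by
        ext <;> simp only [c, g, c1] <;> norm_num <;> omega⟩
    by_cases c2 : (j + k) % 4 = 3
    · exact ⟨(k + (-1 - j - k) / 4, (-1 - j - k) / 4), by
        ext <;> simp only [c, g, c0, c1, c2] <;> norm_num; omega⟩
    · exact ⟨(k + (-3 - j - k) / 4 + 1, (-3 - j - k) / 4), by
        ext <;> simp only [c, g, c0, c1, c2] <;> norm_num <;> omega⟩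
  · intro r hr
    interval_cases r
    · refine h0.of_eq (fun p => ?_) (by norm_num)
      simp [g, e0]
    · refine h1.of_eq (fun p => ?_) (by norm_num)
      simp only [g]
      norm_num
      rw [e1]
      ring
    · refine h0.of_eq (fun p => ?_) (by norm_num)
      simp only [g]
      norm_num
      rw [triangular_neg_one_sub, e0]
    · refine h1.of_eq (fun p => ?_) (by norm_num)
      simp only [g]
      norm_num
      rw [triangular_neg_one_sub, e1]
      ring

/-! ### Moduli 2 and 4 -/

theorem PowerSeries.dvd_expand {k : ℕ} {f : ℤ⟦X⟧} (h : (k : ℤ⟦X⟧) ∣ f) (p : ℕ) (hp : p ≠ 0) :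
    (k : ℤ⟦X⟧) ∣ f.expand p hp := by
  obtain ⟨g, rfl⟩ := h
  rw [map_mul, map_natCast]
  exact dvd_mul_right _ _

theorem PowerSeries.rescale_neg_one_expand_three (f : ℤ⟦X⟧) :
    rescale (-1) (f.expand 3 three_ne_zero) = (rescale (-1) f).expand 3 three_ne_zero := by
  ext n
  rw [coeff_rescale, coeff_expand, coeff_expand]
  split_ifs with h
  · obtain ⟨m, rfl⟩ := h
    rw [Nat.mul_div_cancel_left _ (by norm_num), coeff_rescale, pow_mul]
    norm_num
  · rw [mul_zero]

/-- `ψ(q) ψ(q³) ≡ (q; q)_∞³ (q³; q³)_∞³` modulo 4, dissected. -/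
theorem four_dvd_euler_mul_sub : (4 : ℤ⟦X⟧) ∣ eulerPhi ^ 3 * eulerAt 3 ^ 3 -
    (phiSeries.expand 6 (by norm_num) * psiSeries.expand 4 four_ne_zero +
        X * (phiSeries.expand 2 two_ne_zero * psiSeries.expand 12 (by norm_num))) := by
  have h1 := four_dvd_eulerPhi_pow_three_sub_psiSeries
  have h3 := PowerSeries.dvd_expand (k := 4) (by exact_mod_cast h1) 3 three_ne_zero
  rw [map_sub, map_pow, expand_eulerPhi] at h3
  rw [← psiSeries_mul_expand]
  exact h1.mul_sub_mul (by exact_mod_cast h3)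

theorem two_dvd_euler_mul_sub : (2 : ℤ⟦X⟧) ∣ eulerPhi ^ 3 * eulerAt 3 ^ 3 -
    ((eulerPhi ^ 3).expand 4 four_ne_zero + X * (eulerPhi ^ 3).expand 12 (by norm_num)) := by
  have h24 : (2 : ℤ⟦X⟧) ∣ 4 := ⟨2, by norm_num⟩
  have h0 := h24.trans four_dvd_euler_mul_sub
  have hφ : ∀ p (hp : p ≠ 0), (2 : ℤ⟦X⟧) ∣ phiSeries.expand p hp - 1 := fun p hp => by
    have := PowerSeries.dvd_expand (k := 2) (by exact_mod_cast two_dvd_phiSeries_sub_one) p hp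
    rw [map_sub, map_one] at this
    exact_mod_cast this
  have hψ : ∀ p (hp : p ≠ 0), (2 : ℤ⟦X⟧) ∣ psiSeries.expand p hp - (eulerPhi ^ 3).expand p hp :=
    fun p hp => by
      have := PowerSeries.dvd_expand (k := 2)
        (by exact_mod_cast h24.trans four_dvd_eulerPhi_pow_three_sub_psiSeries) p hp
      rw [map_sub] at this
      rw [dvd_sub_comm]
      exact_mod_cast this
  have h1 := (hφ 6 (by norm_num)).mul_sub_mul (hψ 4 four_ne_zero)
  have h2 := ((hφ 2 two_ne_zero).mul_sub_mul (hψ 12 (by norm_num))).mul_left X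
  rw [one_mul] at h1 h2
  convert dvd_add h0 (dvd_add h1 h2) using 1
  ring

/-- With a = E_4³ and b = E_12³, the denominator e satisfies e ≡ a + qb and e⁴ ≡ e(q⁴) = ab mod 2.
Hence P ab ≡ e³ ≡ (a + qb)(a² + q²b²), that is, P ≡ a²/b + qa + q²b + q³b²/a. -/
theorem exists_mk_p33_dissection_two : ∃ α β z : ℤ⟦X⟧, PowerSeries.mk p33 =
    α.expand 4 four_ne_zero + X ^ 1 * (eulerPhi ^ 3).expand 4 four_ne_zero +
      X ^ 2 * (eulerPhi ^ 3).expand 12 (by norm_num) + X ^ 3 * β.expand 4 four_ne_zero + 2 * z := by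
  obtain ⟨v, hv⟩ := exists_mul_eq_one (g := eulerPhi ^ 3) (by simp [constantCoeff_eulerPhi])
  have h12 : ∀ f : ℤ⟦X⟧, (f.expand 3 three_ne_zero).expand 4 four_ne_zero = f.expand 12 (by norm_num) :=
    fun f => (expand_mul 4 four_ne_zero 3 three_ne_zero f).symm
  have ha := congrArg (PowerSeries.expand 4 four_ne_zero) hv
  have hb := congrArg (PowerSeries.expand 12 (by norm_num)) hv
  rw [map_mul, map_one] at ha hb
  obtain ⟨c₁, h₁⟩ := two_dvd_euler_mul_sub
  set e := eulerPhi ^ 3 * eulerAt 3 ^ 3 with he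
  have hE3 : e = eulerPhi ^ 3 * (eulerPhi ^ 3).expand 3 three_ne_zero := by
    rw [map_pow, expand_eulerPhi]
  obtain ⟨c₄, h₄⟩ := PowerSeries.natCast_dvd_pow_sub_expand 2 e
  obtain ⟨c₅, h₅⟩ := PowerSeries.natCast_dvd_pow_sub_expand 2 (e.expand 2 two_ne_zero)
  have he4 : (e.expand 2 two_ne_zero).expand 2 two_ne_zero =
      (eulerPhi ^ 3).expand 4 four_ne_zero * (eulerPhi ^ 3).expand 12 (by norm_num) := by
    rw [← h12, ← map_mul, ← hE3]
    exact (expand_mul 2 two_ne_zero 2 two_ne_zero e).symm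
  rw [he4] at h₅
  have h₂ : ∃ c₃, e.expand 2 two_ne_zero = (eulerPhi ^ 3).expand 4 four_ne_zero ^ 2 +
      X ^ 2 * (eulerPhi ^ 3).expand 12 (by norm_num) ^ 2 + 2 * c₃ := by
    obtain ⟨c₂, h₂⟩ := PowerSeries.natCast_dvd_pow_sub_expand 2 (e - 2 * c₁)
    have h2' : e - 2 * c₁ = (eulerPhi ^ 3).expand 4 four_ne_zero +
        X * (eulerPhi ^ 3).expand 12 (by norm_num) := by linear_combination h₁
    have h2e : (2 : ℤ⟦X⟧).expand 2 two_ne_zero = 2 := map_ofNat _ 2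
    rw [map_sub, map_mul _ 2 c₁, h2e, h2'] at h₂
    push_cast at h₂
    refine ⟨X * (eulerPhi ^ 3).expand 4 four_ne_zero * (eulerPhi ^ 3).expand 12 (by norm_num) - c₂ +
      c₁.expand 2 two_ne_zero, ?_⟩
    linear_combination -h₂
  obtain ⟨c₃, h₂⟩ := h₂
  have hP := mk_p33_mul_euler
  rw [← he] at hP
  refine ⟨(eulerPhi ^ 3) ^ 2 * v.expand 3 three_ne_zero, ((eulerPhi ^ 3) ^ 2).expand 3 three_ne_zero * v,
    v.expand 4 four_ne_zero * v.expand 12 (by norm_num) * (c₁ * e.expand 2 two_ne_zero +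
      ((eulerPhi ^ 3).expand 4 four_ne_zero + X * (eulerPhi ^ 3).expand 12 (by norm_num)) * c₃ -
      c₄ * PowerSeries.mk p33 * e.expand 2 two_ne_zero - PowerSeries.mk p33 * c₅), ?_⟩
  rw [map_mul, map_mul, h12, h12, map_pow _ (eulerPhi ^ 3) 2, map_pow _ (eulerPhi ^ 3) 2]
  set a := (eulerPhi ^ 3).expand 4 four_ne_zero
  set b := (eulerPhi ^ 3).expand 12 (by norm_num)
  set a' := v.expand 4 four_ne_zero
  set b' := v.expand 12 (by norm_num)
  set P := PowerSeries.mk p33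
  set e₂ := e.expand 2 two_ne_zero
  push_cast at h₄ h₅
  have hab : P * (a * b) = (a + X * b) * (a ^ 2 + X ^ 2 * b ^ 2) + 2 * (c₁ * e₂ + (a + X * b) * c₃ -
      c₄ * P * e₂ - P * c₅) := by
    linear_combination (-P) * h₅ - P * e₂ * h₄ + e * e₂ * hP + e₂ * h₁ + (a + X * b) * h₂
  linear_combination a' * b' * hab - P * (b * b' * ha + hb) +
    (a ^ 2 * b' + X * a * b * b' + X ^ 2 * b ^ 2 * b') * ha + (X * a + X ^ 2 * b) * hb +
    X ^ 3 * b ^ 2 * a' * hb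

/-- Exponents 2 mod 4 come from q² E_12³, which lives on exponents 2 mod 12. -/
theorem coeffDvd_two_p33_six : CoeffDvd 2 12 6 (PowerSeries.mk p33) := by
  obtain ⟨α, β, z, h⟩ := exists_mk_p33_dissection_two
  have h4 : (4 : ℕ) ∣ 12 := by norm_num
  rw [h]
  refine ((((CoeffDvd.expand four_ne_zero h4 (by norm_num) _).add ?_).add ?_).add ?_).add
    (CoeffDvd.of_dvd (by exact_mod_cast dvd_mul_right (2 : ℤ⟦X⟧) z))
  · exact CoeffDvd.X_pow_mul_expand four_ne_zero h4 (by norm_num) (by norm_num) _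
  · exact CoeffDvd.X_pow_mul_expand (by norm_num) (dvd_refl 12) (by norm_num) (by norm_num) _
  · exact CoeffDvd.X_pow_mul_expand four_ne_zero h4 (by norm_num) (by norm_num) _

theorem eulerPhi_pow_three_eq_expand : eulerPhi ^ 3 =
    cubicTheta.expand 3 three_ne_zero - X * (3 * eulerAt 3 ^ 3).expand 3 three_ne_zero := by
  rw [eulerPhi_pow_three_dissection, expand_three_eulerAt_three, map_mul, map_pow,
    show (3 : ℤ⟦X⟧).expand 3 three_ne_zero = 3 from map_ofNat _ 3]
  ring

/-- Exponents 1 mod 4 come from q E_4³. Since E_1³ has no exponents 2 mod 3, only 1 and 5 mod 12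
occur. -/
theorem coeffDvd_two_p33_nine : CoeffDvd 2 12 9 (PowerSeries.mk p33) := by
  obtain ⟨α, β, z, h⟩ := exists_mk_p33_dissection_two
  have h4 : (4 : ℕ) ∣ 12 := by norm_num
  have h12 : ∀ f : ℤ⟦X⟧, (f.expand 3 three_ne_zero).expand 4 four_ne_zero = f.expand 12 (by norm_num) :=
    fun f => (expand_mul 4 four_ne_zero 3 three_ne_zero f).symm
  rw [h]
  refine ((((CoeffDvd.expand four_ne_zero h4 (by norm_num) _).add ?_).add ?_).add ?_).add
    (CoeffDvd.of_dvd (by exact_mod_cast dvd_mul_right (2 : ℤ⟦X⟧) z))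
  · rw [eulerPhi_pow_three_eq_expand, map_sub, map_mul, expand_X, h12, h12, mul_sub, ← mul_assoc,
      ← pow_add]
    exact (CoeffDvd.X_pow_mul_expand (by norm_num) (dvd_refl 12) (by norm_num) (by norm_num) _).sub
      (CoeffDvd.X_pow_mul_expand (by norm_num) (dvd_refl 12) (by norm_num) (by norm_num) _)
  · exact CoeffDvd.X_pow_mul_expand (by norm_num) (dvd_refl 12) (by norm_num) (by norm_num) _
  · exact CoeffDvd.X_pow_mul_expand four_ne_zero h4 (by norm_num) (by norm_num) _

/-- E_1 = (q; q²)_∞ E_2, and (q; q²)_∞ (−q; q²)_∞ = (q²; q⁴)_∞ = E_2/E_4. -/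
theorem eulerPhi_mul_rescale_neg_one : eulerPhi * rescale (-1) eulerPhi * eulerAt 4 = eulerAt 2 ^ 3 := by
  have hX : constantCoeff ((X : ℤ⟦X⟧) ^ 2) = 0 := constantCoeff_X_pow two_ne_zero
  have h1 := eulerPhi_eq_qPoch_mul
  have hX2 : rescale (-1 : ℤ) (X ^ 2) = X ^ 2 := by rw [map_pow, rescale_neg_one_X, neg_sq]
  have h2 := congrArg (rescale (-1 : ℤ)) h1
  have hE2 : rescale (-1 : ℤ) (eulerAt 2) = eulerAt 2 := by
    rw [eulerAt, map_qPoch _ (PowerSeries.continuous_rescale _) _ hX, hX2]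
  rw [map_mul, map_qPoch _ (PowerSeries.continuous_rescale _) _ hX, hX2, rescale_neg_one_X, hE2] at h2
  have h3 := congrArg (PowerSeries.expand 2 two_ne_zero) h1
  rw [map_mul, expand_eulerPhi, expand_qPoch _ _ _ hX, expand_eulerAt _ two_ne_zero, map_pow, expand_X,
    ← qPoch_mul_qPoch_neg _ hX] at h3
  rw [h2, h1]
  linear_combination (-(eulerAt 2 ^ 2)) * h3

/-- Multiplying the denominator by its value at −q gives the even series (E_2 E_6)⁹/(E_4 E_12)³, so
mod 4 the even part of P is α (E_4 E_12)³/(E_2 E_6)⁹ with α = φ(q⁶)ψ(q⁴). Here α ≡ E_6² E_4³/E_12,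
and E_4² ≡ E_2⁴, E_12² ≡ E_6⁴ reduce it to E_2³/E_6³. The dissection at q² shows that E_2³ has no
exponents 4 mod 6. -/
theorem coeffDvd_four_p33 : CoeffDvd 4 6 4 (PowerSeries.mk p33) := by
  obtain ⟨c, hc⟩ := four_dvd_euler_mul_sub
  obtain ⟨d, hd⟩ := four_dvd_phiSeries_sub
  obtain ⟨c', hc'⟩ := four_dvd_eulerPhi_pow_three_sub_psiSeries
  obtain ⟨v, hv⟩ := exists_mul_eq_one (g := eulerPhi ^ 9) (by simp [constantCoeff_eulerPhi])
  have h6 : ∀ f : ℤ⟦X⟧, (f.expand 3 three_ne_zero).expand 2 two_ne_zero = f.expand 6 (by norm_num) :=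
    fun f => (expand_mul 2 two_ne_zero 3 three_ne_zero f).symm
  have h4 : ∀ f : ℤ⟦X⟧, (f.expand 2 two_ne_zero).expand 2 two_ne_zero = f.expand 4 four_ne_zero :=
    fun f => (expand_mul 2 two_ne_zero 2 two_ne_zero f).symm
  have h12 : ∀ f : ℤ⟦X⟧, (f.expand 6 (by norm_num)).expand 2 two_ne_zero = f.expand 12 (by norm_num) :=
    fun f => (expand_mul 2 two_ne_zero 6 (by norm_num) f).symm
  have hres : ∀ f : ℤ⟦X⟧, rescale (-1) (f.expand 2 two_ne_zero) = f.expand 2 two_ne_zero :=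
    PowerSeries.rescale_expand_of_pow_eq_one two_ne_zero (by norm_num)
  set β := phiSeries.expand 2 two_ne_zero * psiSeries.expand 12 (by norm_num) with hβ
  have hβ' : β = (phiSeries * psiSeries.expand 6 (by norm_num)).expand 2 two_ne_zero := by
    rw [map_mul, h12]
  set α := phiSeries.expand 6 (by norm_num) * psiSeries.expand 4 four_ne_zero with hα
  have hα' : α = (phiSeries.expand 3 three_ne_zero * psiSeries.expand 2 two_ne_zero).expand 2 two_ne_zero := by
    rw [map_mul, h4, h6]
  -- the product of the denominator with its image under `q ↦ -q`
  have hN1 := eulerPhi_mul_rescale_neg_one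
  have hN3 := congrArg (PowerSeries.expand 3 three_ne_zero) hN1
  rw [map_mul, map_mul, ← PowerSeries.rescale_neg_one_expand_three, map_pow, expand_eulerPhi,
    expand_eulerAt _ four_ne_zero, expand_eulerAt _ two_ne_zero] at hN3
  norm_num at hN3
  have hR := congrArg (rescale (-1 : ℤ)) hc
  rw [map_sub, map_add, map_mul, map_mul _ X, map_mul _ 4, map_pow, map_pow, hα', hres, ← hα', hβ', hres,
    ← hβ', rescale_neg_one_X, map_ofNat] at hR
  -- `α` modulo 4
  have hθ : phiSeries * eulerAt 2 = eulerPhi ^ 2 + 4 * (d * eulerAt 2) := by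
    rw [eulerPhi_eq_qPoch_mul]
    linear_combination eulerAt 2 * hd
  have hθ6 := congrArg (PowerSeries.expand 6 (by norm_num)) hθ
  have hψ4 := congrArg (PowerSeries.expand 4 four_ne_zero) hc'
  simp only [map_mul, map_add, map_sub, map_pow, map_ofNat, expand_eulerPhi,
    expand_eulerAt (show (6 : ℕ) ≠ 0 by norm_num) two_ne_zero] at hθ6 hψ4
  norm_num at hθ6
  -- squares modulo 4
  have hsq : ∀ m, m ≠ 0 → (4 : ℤ⟦X⟧) ∣ eulerAt (2 * m) ^ 2 - eulerAt m ^ 4 := fun m hm => by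
    have h2 := natCast_dvd_eulerAt_pow_sub 2 hm
    have := dvd_sub_pow_of_dvd_sub (p := 2) h2 1
    rw [dvd_sub_comm]
    norm_num [← pow_mul] at this
    exact this
  have hs := ((hsq 2 two_ne_zero).trans (sub_dvd_pow_sub_pow _ _ 3)).mul_sub_mul (hsq 6 (by norm_num))
  obtain ⟨z, hz⟩ := hs
  norm_num at hz
  have hP := mk_p33_mul_euler
  have hv2 := congrArg (PowerSeries.expand 2 two_ne_zero) hv
  rw [map_mul, map_pow, expand_eulerPhi, map_one] at hv2
  have hD := congrArg (PowerSeries.expand 2 two_ne_zero) eulerPhi_pow_three_eq_expand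
  rw [map_sub, map_mul, expand_X, h6, h6, map_pow, expand_eulerPhi] at hD
  set P := PowerSeries.mk p33
  set R₁ := rescale (-1) eulerPhi
  set R₃ := rescale (-1) (eulerAt 3)
  set V := v.expand 2 two_ne_zero
  have hmain : ∃ y, eulerAt 6 ^ 9 * P = eulerAt 6 ^ 6 * eulerAt 2 ^ 3 -
      X * (V * β * eulerAt 4 ^ 3 * eulerAt 12 ^ 3) + 4 * y := by
    have hprod : eulerAt 2 ^ 9 * eulerAt 6 ^ 9 * P = R₁ ^ 3 * R₃ ^ 3 * (eulerAt 4 ^ 3 * eulerAt 12 ^ 3) := by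
      have i1 := congrArg (· ^ 3) hN1
      have i3 := congrArg (· ^ 3) hN3
      linear_combination (R₁ ^ 3 * R₃ ^ 3 * (eulerAt 4 ^ 3 * eulerAt 12 ^ 3)) * hP -
        P * eulerAt 6 ^ 9 * i1 - P * (eulerPhi * R₁ * eulerAt 4) ^ 3 * i3
    refine ⟨V * (eulerAt 6 ^ 2 * z + eulerAt 4 ^ 3 * eulerAt 12 ^ 3 * rescale (-1) c +
      eulerAt 4 ^ 3 * eulerAt 12 ^ 2 * (d.expand 6 (by norm_num) * eulerAt 12 * psiSeries.expand 4 four_ne_zero -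
        c'.expand 4 four_ne_zero * eulerAt 6 ^ 2)), ?_⟩
    have hα12 : α * eulerAt 12 = eulerAt 6 ^ 2 * eulerAt 4 ^ 3 + 4 * (d.expand 6 (by norm_num) *
        eulerAt 12 * psiSeries.expand 4 four_ne_zero - c'.expand 4 four_ne_zero * eulerAt 6 ^ 2) := by
      rw [hα]
      linear_combination psiSeries.expand 4 four_ne_zero * hθ6 - eulerAt 6 ^ 2 * hψ4
    linear_combination V * hprod + V * eulerAt 4 ^ 3 * eulerAt 12 ^ 3 * hR +
      V * eulerAt 4 ^ 3 * eulerAt 12 ^ 2 * hα12 + V * eulerAt 6 ^ 2 * hz -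
      (eulerAt 6 ^ 9 * P - eulerAt 6 ^ 6 * eulerAt 2 ^ 3) * hv2
  obtain ⟨y, hy⟩ := hmain
  have hE6 : (eulerPhi ^ 9).expand 6 (by norm_num) = eulerAt 6 ^ 9 := by rw [map_pow, expand_eulerPhi]
  refine CoeffDvd.of_expand_mul (g := eulerPhi ^ 9) (by norm_num) (by simp [constantCoeff_eulerPhi]) ?_
  rw [hE6, hy, hD]
  refine CoeffDvd.add (CoeffDvd.sub ?_ ?_) (CoeffDvd.of_dvd (by exact_mod_cast dvd_mul_right (4 : ℤ⟦X⟧) y))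
  · have := (((CoeffDvd.expand (k := 4) (m := 6) (r := 4) (by norm_num) (dvd_refl 6) (by norm_num)
      cubicTheta).sub (CoeffDvd.X_pow_mul_expand (i := 2) (by norm_num) (dvd_refl 6) (by norm_num)
        (by norm_num) (3 * eulerAt 3 ^ 3)))).expand_mul (by norm_num) (eulerPhi ^ 6)
    rwa [map_pow, expand_eulerPhi] at this
  · have := CoeffDvd.X_pow_mul_expand (k := 4) (m := 6) (r := 4) (i := 1) two_ne_zero (by norm_num)
      (by norm_num) (by norm_num) (v * (phiSeries * psiSeries.expand 6 (by norm_num)) * eulerAt 2 ^ 3 *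
        eulerAt 6 ^ 3)
    simp only [map_mul _ _ (eulerAt 6 ^ 3), map_mul _ _ (eulerAt 2 ^ 3), map_mul _ v, ← hβ', map_pow,
      expand_eulerAt two_ne_zero two_ne_zero, expand_eulerAt two_ne_zero (show (6 : ℕ) ≠ 0 by norm_num)] at this
    rwa [pow_one] at this

theorem theorem1 (n : ℕ) :
    p33 (12 * n + 6) ≡ 0 [ZMOD 2] ∧
    p33 (12 * n + 9) ≡ 0 [ZMOD 2] ∧
    p33 (6 * n + 4) ≡ 0 [ZMOD 4] ∧
    p33 (3 * n + 1) ≡ 0 [ZMOD 3] ∧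
    p33 (3 * n + 2) ≡ 0 [ZMOD 9] ∧
    p33 (9 * n + 5) ≡ 0 [ZMOD 27] ∧
    p33 (9 * n + 8) ≡ 0 [ZMOD 27] ∧
    p33 (5 * n + 3) ≡ 0 [ZMOD 5] :=
  ⟨coeffDvd_two_p33_six.p33 n, coeffDvd_two_p33_nine.p33 n, coeffDvd_four_p33.p33 n,
    coeffDvd_three_p33.p33 n, coeffDvd_nine_p33.p33 n, (coeffDvd_twentySeven_p33 (Or.inl rfl)).p33 n,
    (coeffDvd_twentySeven_p33 (Or.inr rfl)).p33 n, coeffDvd_five_p33.p33 n⟩
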